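/- Let $p\ge 1$ and let $X_{k,n}$ ($1\le k\le p$, $n\ge 1$) be the observations of $p$ independent data streams, all independent and normal with variance $1$. Under $\mathbb P_\infty$ all means are $0$; under $\mathbb P_{\mu,\nu}$, where $\mu=(\mu_1,\dots,\mu_p)\in\mathbb R^p$ and $1\le\nu<\infty$, the mean of $X_{k,n}$ is $0$ for $n<\nu$ and $\mu_k$ for $n\ge\nu$. Let $\mathcal F_n$ be the $\sigma$-algebra generated by $X_{k,i}$, $1\le k\le p$, $1\le i\le n$. For a random time $T$ with values in $\{0,1,2,\dots,\infty\}$ put $$D_\mu(T)=\sup_{1\le \nu<\infty}\operatorname{ess\,sup}\ \mathbb E_{\mu,\nu}\bigl(T-\nu+1\mid T\ge\nu,\ \mathcal F_{\nu-1}\bigr).$$ Fix $0\le c\le 1$ and $\omega\in\mathbb R^p$. Let $f_\theta$ be the $N(\theta,1)$ density and define $$\hat\mu_{k,m,\ell}=\omega_k+c\Bigl(\frac{X_{k,m}+\dots+X_{k,\ell-1}}{\ell-m}-\omega_k\Bigr)\ (\ell>m),\qquad \hat\mu_{k,m,m}=0,$$ $$\Lambda_{n,m}=\prod_{\ell=m}^n\prod_{k=1}^p\frac{f_{\hat\mu_{k,m,\ell}}(X_{k,\ell})}{f_0(X_{k,\ell})},\qquad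 N_B=\inf\Bigl\{n\ge1:\ \sum_{m=1}^n\Lambda_{n,m}\ge B\Bigr\}\quad(\inf\emptyset=\infty).$$ (i) For all $0<B<\infty$, $\ \mathbb E_\infty(N_B)\ge B$. (ii) Let $\mu\in\mathbb R^p$, $\mu^*_k=c\mu_k+(1-c)\omega_k$, and let $$I=I(\mu^*,0;\mu)=\mathbb E\sum_{k=1}^p\log\frac{f_{\mu^*_k}(Y_k)}{f_0(Y_k)}\ \Bigl(=\tfrac12\bigl[\|\mu\|^2-(1-c)^2\|\mu-\omega\|^2\bigr]\Bigr),$$ where $Y_1,\dots,Y_p$ are independent with $Y_k\sim N(\mu_k,1)$. If $I>0$, then, with $p,c,\omega,\mu$ fixed and $B\to\infty$, $$D_\mu(N_B)\le\frac{\log B+\frac{pc^2}{2}\log\log B-\frac{pc^2}{2}\log I}{I}+o(p\log\log B).$$ -/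

import Mathlib

open scoped ENNReal

namespace SRRS

noncomputable section

/-- The data of `p` streams: `x n k` is the observation `X_{k,n}` of stream `k` at time `n`.
Observation times are `n = 1, 2, …`; the entry `x 0` is padding that nothing below looks at. -/
abbrev Obs (p : ℕ) : Type := ℕ → Fin p → ℝ

/-- The σ-algebras `ℱ n` of all information up to time `n`, generated by the observations of all
streams at the times `1, …, n`; in particular `ℱ 0` is trivial. -/
def info (p : ℕ) : MeasureTheory.Filtration ℕ (inferInstance : MeasurableSpace (Obs p)) where
  seq n := ⨆ i ∈ Finset.Icc 1 n, MeasurableSpace.comap (fun x : Obs p => x i) inferInstance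
  mono' := fun _ _ h => biSup_mono fun _ hi =>
    Finset.mem_Icc.2 ⟨(Finset.mem_Icc.1 hi).1, (Finset.mem_Icc.1 hi).2.trans h⟩
  le' := fun _ => iSup₂_le fun i _ => (measurable_pi_apply i).comap_le

/-- The law of one observation vector: independent normal coordinates, the `k`-th with mean `m k`
and variance `1`. -/
def obsLaw {p : ℕ} (m : Fin p → ℝ) : MeasureTheory.Measure (Fin p → ℝ) :=
  MeasureTheory.Measure.pi fun k => ProbabilityTheory.gaussianReal (m k) 1

/-- `P_∞`: no change, all observations are independent `N(0,1)`. -/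
def lawNoChange (p : ℕ) : MeasureTheory.Measure (Obs p) :=
  MeasureTheory.Measure.infinitePi fun _ : ℕ => obsLaw (0 : Fin p → ℝ)

/-- `P_{μ,ν}`: all observations are independent with variance `1`; in stream `k` the mean is `0`
before time `ν` and `μ k` from time `ν` on. -/
def lawChange {p : ℕ} (μ : Fin p → ℝ) (ν : ℕ) : MeasureTheory.Measure (Obs p) :=
  MeasureTheory.Measure.infinitePi fun n : ℕ => obsLaw (if ν ≤ n then μ else 0)

/-- The linear shrinkage estimator `ω_k + c ((X_{k,m} + ⋯ + X_{k,ℓ-1}) / (ℓ - m) - ω_k)` for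
`ℓ > m`, and `0` for `ℓ = m`, when there is no observation to estimate from. -/
def estimate {p : ℕ} (c : ℝ) (ω : Fin p → ℝ) (x : Obs p) (k : Fin p) (m ℓ : ℕ) : ℝ :=
  if ℓ ≤ m then 0
  else ω k + c * ((∑ i ∈ Finset.Ico m ℓ, x i k) / ((ℓ : ℝ) - (m : ℝ)) - ω k)

/-- The plug-in likelihood ratio `Λ_{n,m}`. -/
def plugInLR {p : ℕ} (c : ℝ) (ω : Fin p → ℝ) (n m : ℕ) (x : Obs p) : ℝ :=
  ∏ ℓ ∈ Finset.Icc m n, ∏ k : Fin p,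
    ProbabilityTheory.gaussianPDFReal (estimate c ω x k m ℓ) 1 (x ℓ k) /
      ProbabilityTheory.gaussianPDFReal 0 1 (x ℓ k)

/-- The detection statistic `∑_{m=1}^n Λ_{n,m}`. -/
def statistic {p : ℕ} (c : ℝ) (ω : Fin p → ℝ) (n : ℕ) (x : Obs p) : ℝ :=
  ∑ m ∈ Finset.Icc 1 n, plugInLR c ω n m x

/-- The alarm time `N_B = inf {n ≥ 1 : ∑_{m=1}^n Λ_{n,m} ≥ B}`, which is `∞` if there is no such
`n`. -/
def alarmTime {p : ℕ} (c : ℝ) (ω : Fin p → ℝ) (B : ℝ) : Obs p → ℕ∞ :=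
  MeasureTheory.hittingAfter (statistic c ω) (Set.Ici B) 1

/-- `E_∞(T)`, the average run length to false alarm. -/
def avgRunLength {p : ℕ} (T : Obs p → ℕ∞) : ℝ≥0∞ :=
  ∫⁻ x, (T x : ℝ≥0∞) ∂(lawNoChange p)

/-- The worst-case detection delay
`D_μ(T) = sup_{1 ≤ ν < ∞} ess sup E_{μ,ν}(T - ν + 1 | T ≥ ν, ℱ_{ν-1})`. The essential supremum is
over the event `T ≥ ν`, on which the (truncated) subtraction in `T + 1 - ν` is exact. -/
def detectionDelay {p : ℕ} (μ : Fin p → ℝ) (T : Obs p → ℕ∞) : ℝ≥0∞ :=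
  ⨆ (ν : ℕ) (_ : 1 ≤ ν),
    essSup
      (MeasureTheory.condLExp (info p (ν - 1)) (lawChange μ ν)
        (fun x => (T x : ℝ≥0∞) + 1 - (ν : ℝ≥0∞)))
      ((lawChange μ ν).restrict {x | (ν : ℕ∞) ≤ T x})

/-- `μ*_k = c μ_k + (1 - c) ω_k`, the limit of the estimator when the true mean is `μ_k`. -/
def muStar {p : ℕ} (c : ℝ) (ω μ : Fin p → ℝ) : Fin p → ℝ :=
  fun k => c * μ k + (1 - c) * ω k

/-- The information number `I(θ, φ; μ) = E_μ ∑_k log (f_{θ_k}(X_k) / f_{φ_k}(X_k))`. -/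
def infoNumber {p : ℕ} (θ φ μ : Fin p → ℝ) : ℝ :=
  ∫ y, ∑ k : Fin p, Real.log
    (ProbabilityTheory.gaussianPDFReal (θ k) 1 (y k) /
      ProbabilityTheory.gaussianPDFReal (φ k) 1 (y k)) ∂(obsLaw μ)

end

end SRRS

/-
Part (i). Under `P_∞` the statistic minus the elapsed time is a martingale, since each `Λ_{n,m}` is
a likelihood ratio against `P_∞`; stopping at the alarm, where the statistic is at least `B`, gives
`B ≤ E_∞ N_B`.

Part (ii). Given the past, the delay after a change at `ν` is at most the first time `log Λ_{n,1}`
exceeds `b = log B` for a change at time `1`. There `log Λ_{n,1}` is a random walk with drift `I`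
plus a remainder `c ⟨Z̄_l, μ - μ* + Z_l⟩ - c²/2 ‖Z̄_l‖²` at each step, where `Z_l` is the noise and
`Z̄_l` the mean of `l` noise terms. Let `τ` be the passage time restricted to the window `[m, 8m]`
with `m ≈ b / (2I)`. Wald's identity at `τ` leaves three errors. As `E ‖Z̄_l‖² = p / l`, the
quadratic term costs `(p c² / 2) log b`, and the term linear in `Z̄_l` is bounded after an Abel
summation, because `τ` fluctuates by `O(√m)` only. The overshoot is `o(log b)`, since the largest of
`8m` Gaussian increments is. Fourth moments bound the cost of leaving the window.
-/

open MeasureTheory ProbabilityTheory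

namespace SRRS

section StoppingTimes

theorem toENNReal_eq_tsum_indicator (t : ℕ∞) :
    (t : ℝ≥0∞) = ∑' n : ℕ, {n : ℕ | (n : ℕ∞) < t}.indicator 1 n := by
  induction t using ENat.recTopCoe with
  | top => simp
  | coe t =>
    rw [tsum_eq_sum (s := Finset.range t) fun n hn => by simpa [Set.indicator] using hn,
      Finset.sum_congr rfl fun n hn => Set.indicator_of_mem (by simpa using hn) _]
    simp

variable {Ω : Type*} {mΩ : MeasurableSpace Ω} {T : Ω → ℕ∞}

theorem toENNReal_comp_eq_tsum_indicator (T : Ω → ℕ∞) (x : Ω) :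
    (T x : ℝ≥0∞) = ∑' n : ℕ, {x | (n : ℕ∞) < T x}.indicator 1 x :=
  toENNReal_eq_tsum_indicator (T x)

theorem measurable_toENNReal (hT : ∀ n : ℕ, MeasurableSet {x | (n : ℕ∞) < T x}) :
    Measurable fun x => (T x : ℝ≥0∞) := by
  simp_rw [toENNReal_comp_eq_tsum_indicator]
  exact Measurable.tsum fun n => measurable_one.indicator (hT n)

theorem lintegral_toENNReal (P : Measure Ω) (hT : ∀ n : ℕ, MeasurableSet {x | (n : ℕ∞) < T x}) :
    ∫⁻ x, (T x : ℝ≥0∞) ∂P = ∑' n : ℕ, P {x | (n : ℕ∞) < T x} := by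
  simp_rw [toENNReal_comp_eq_tsum_indicator]
  rw [lintegral_tsum fun n => (measurable_one.indicator (hT n)).aemeasurable]
  exact tsum_congr fun n => lintegral_indicator_one (hT n)

theorem setOf_lt_eq_union (T : Ω → ℕ∞) (n : ℕ) :
    {x | (n : ℕ∞) < T x} = {x | ((n + 1 : ℕ) : ℕ∞) < T x} ∪ {x | T x = ((n + 1 : ℕ) : ℕ∞)} := by
  ext x
  simp only [Set.mem_union, Set.mem_ofPred_eq, Nat.cast_succ]
  rw [← ENat.add_one_le_iff (ENat.natCast_ne_top n), le_iff_lt_or_eq, eq_comm (a := T x)]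

variable {F : Filtration ℕ mΩ} {u : ℕ → Ω → ℝ} {P : Measure Ω} {B : ℝ}

theorem setLIntegral_add_mul_measure_le (hT : ∀ n : ℕ, MeasurableSet[F n] {x | (n : ℕ∞) < T x})
    (hB : ∀ n : ℕ, ∀ x, T x = n → B ≤ u n x) (n : ℕ) :
    (∫⁻ x in {x | ((n + 1 : ℕ) : ℕ∞) < T x}, ENNReal.ofReal (u (n + 1) x) ∂P)
      + ENNReal.ofReal B * P {x | T x = ((n + 1 : ℕ) : ℕ∞)}
    ≤ ∫⁻ x in {x | (n : ℕ∞) < T x}, ENNReal.ofReal (u (n + 1) x) ∂P := by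
  have hdisj : Disjoint {x | T x = ((n + 1 : ℕ) : ℕ∞)} {x | ((n + 1 : ℕ) : ℕ∞) < T x} :=
    Set.disjoint_left.2 fun x heq hlt => (ne_of_gt hlt) heq
  have hexit : MeasurableSet {x | T x = ((n + 1 : ℕ) : ℕ∞)} := by
    rw [← hdisj.sdiff_eq_left, ← Set.union_sdiff_right, Set.union_comm, ← setOf_lt_eq_union]
    exact (F.le _ _ (hT n)).diff (F.le _ _ (hT (n + 1)))
  rw [setOf_lt_eq_union T n, lintegral_union hexit hdisj.symm, ← setLIntegral_const]
  gcongr _ + ?_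
  exact setLIntegral_mono' hexit fun x hx => ENNReal.ofReal_le_ofReal (hB _ x hx)

theorem setLIntegral_add_mul_measure_le_sum
    (hT : ∀ n : ℕ, MeasurableSet[F n] {x | (n : ℕ∞) < T x})
    (hB : ∀ n : ℕ, ∀ x, T x = n → B ≤ u n x) (h0 : u 0 ≤ 0)
    (hstep : ∀ n A, MeasurableSet[F n] A → ∫⁻ x in A, ENNReal.ofReal (u (n + 1) x) ∂P
      ≤ ∫⁻ x in A, ENNReal.ofReal (u n x) ∂P + P A) (N : ℕ) :
    (∫⁻ x in {x | (N : ℕ∞) < T x}, ENNReal.ofReal (u N x) ∂P)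
      + ENNReal.ofReal B * P {x | T x ≤ (N : ℕ∞)}
    ≤ ∑ n ∈ Finset.range N, P {x | (n : ℕ∞) < T x} := by
  induction N with
  | zero =>
    have hnone : ENNReal.ofReal B * P {x | T x = 0} = 0 := by
      rcases Set.eq_empty_or_nonempty {x | T x = 0} with h | ⟨x, hx⟩
      · rw [h, measure_empty, mul_zero]
      · rw [ENNReal.ofReal_of_nonpos ((hB 0 x hx).trans (h0 x)), zero_mul]
    simpa [ENNReal.ofReal_of_nonpos (h0 _)] using hnone
  | succ N ih =>
    have hle : {x | T x ≤ ((N + 1 : ℕ) : ℕ∞)}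
        ⊆ {x | T x ≤ (N : ℕ∞)} ∪ {x | T x = ((N + 1 : ℕ) : ℕ∞)} := fun x hx =>
      (le_iff_lt_or_eq.1 hx).imp_left fun h => ENat.lt_natCast_add_one_iff.1 h
    calc (∫⁻ x in {x | ((N + 1 : ℕ) : ℕ∞) < T x}, ENNReal.ofReal (u (N + 1) x) ∂P)
          + ENNReal.ofReal B * P {x | T x ≤ ((N + 1 : ℕ) : ℕ∞)}
      _ ≤ (∫⁻ x in {x | ((N + 1 : ℕ) : ℕ∞) < T x}, ENNReal.ofReal (u (N + 1) x) ∂P)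
          + ENNReal.ofReal B * (P {x | T x ≤ (N : ℕ∞)} + P {x | T x = ((N + 1 : ℕ) : ℕ∞)}) := by
        gcongr
        exact (measure_mono hle).trans (measure_union_le _ _)
      _ = ((∫⁻ x in {x | ((N + 1 : ℕ) : ℕ∞) < T x}, ENNReal.ofReal (u (N + 1) x) ∂P)
          + ENNReal.ofReal B * P {x | T x = ((N + 1 : ℕ) : ℕ∞)})
          + ENNReal.ofReal B * P {x | T x ≤ (N : ℕ∞)} := by ring
      _ ≤ ((∫⁻ x in {x | (N : ℕ∞) < T x}, ENNReal.ofReal (u N x) ∂P) + P {x | (N : ℕ∞) < T x})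
          + ENNReal.ofReal B * P {x | T x ≤ (N : ℕ∞)} := by
        gcongr ?_ + _
        exact (setLIntegral_add_mul_measure_le hT hB N).trans (hstep N _ (hT N))
      _ = ((∫⁻ x in {x | (N : ℕ∞) < T x}, ENNReal.ofReal (u N x) ∂P)
          + ENNReal.ofReal B * P {x | T x ≤ (N : ℕ∞)}) + P {x | (N : ℕ∞) < T x} := by ring
      _ ≤ ∑ n ∈ Finset.range (N + 1), P {x | (n : ℕ∞) < T x} := by
        rw [Finset.sum_range_succ]
        gcongr

theorem ofReal_le_lintegral_of_le_at_stop [IsProbabilityMeasure P]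
    (hT : ∀ n : ℕ, MeasurableSet[F n] {x | (n : ℕ∞) < T x})
    (hB : ∀ n : ℕ, ∀ x, T x = n → B ≤ u n x) (h0 : u 0 ≤ 0)
    (hstep : ∀ n A, MeasurableSet[F n] A → ∫⁻ x in A, ENNReal.ofReal (u (n + 1) x) ∂P
      ≤ ∫⁻ x in A, ENNReal.ofReal (u n x) ∂P + P A) :
    ENNReal.ofReal B ≤ ∫⁻ x, (T x : ℝ≥0∞) ∂P := by
  have hmeas : ∀ n : ℕ, MeasurableSet {x | (n : ℕ∞) < T x} := fun n => F.le n _ (hT n)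
  rw [lintegral_toENNReal P hmeas]
  by_cases htop : ∑' n : ℕ, P {x | (n : ℕ∞) < T x} = ⊤
  · rw [htop]; exact le_top
  have hlim : Filter.Tendsto (fun N : ℕ => ENNReal.ofReal B * (1 - P {x | (N : ℕ∞) < T x}))
      Filter.atTop (nhds (ENNReal.ofReal B * (1 - 0))) :=
    ENNReal.Tendsto.const_mul (ENNReal.Tendsto.sub tendsto_const_nhds
      (ENNReal.tendsto_atTop_zero_of_tsum_ne_top htop) (Or.inl ENNReal.one_ne_top))
      (Or.inr ENNReal.ofReal_ne_top)
  rw [tsub_zero, mul_one] at hlim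
  refine le_of_tendsto' hlim fun N => ?_
  have hcompl : {x | (N : ℕ∞) < T x}ᶜ = {x | T x ≤ (N : ℕ∞)} := by ext; simp
  rw [← prob_compl_eq_one_sub (hmeas N), hcompl]
  exact (le_add_self.trans (setLIntegral_add_mul_measure_le_sum hT hB h0 hstep N)).trans
    (ENNReal.sum_le_tsum _)

theorem measurableSet_lt_hittingAfter (hu : Adapted F u) (B : ℝ) (k n : ℕ) :
    MeasurableSet[F n] {x | (n : ℕ∞) < hittingAfter u (Set.Ici B) k x} :=
  (hu.isStoppingTime_hittingAfter measurableSet_Ici).measurableSet_gt n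

theorem le_of_hittingAfter_eq {k n : ℕ} {x : Ω}
    (h : hittingAfter u (Set.Ici B) k x = (n : ℕ∞)) : B ≤ u n x := by
  have hmem : u (hittingAfter u (Set.Ici B) k x).untopA x ∈ Set.Ici B :=
    hittingAfter_mem_set_of_ne_top (h ▸ ENat.natCast_ne_top n)
  rw [h] at hmem
  exact hmem

end StoppingTimes

section Independence

variable {Ω : Type*} {m₀ : MeasurableSpace Ω} {P : Measure Ω} [IsProbabilityMeasure P]

theorem lintegral_comp_prodMk_of_indepFun {β γ : Type*} [MeasurableSpace β] [MeasurableSpace γ]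
    {Z : Ω → β} {X : Ω → γ} (h : IndepFun Z X P) (hZ : Measurable Z) (hX : Measurable X)
    {f : β × γ → ℝ≥0∞} (hf : Measurable f) :
    ∫⁻ x, f (Z x, X x) ∂P = ∫⁻ x, ∫⁻ y, f (Z x, y) ∂(P.map X) ∂P := by
  have : IsProbabilityMeasure (P.map X) := Measure.isProbabilityMeasure_map hX.aemeasurable
  rw [← lintegral_map hf (hZ.prodMk hX),
    (indepFun_iff_map_prod_eq_prod_map_map hZ.aemeasurable hX.aemeasurable).1 h,
    lintegral_prod _ hf.aemeasurable, lintegral_map hf.lintegral_prod_right' hZ]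

theorem condLExp_ae_eq_lintegral_of_indep {m m' : MeasurableSpace Ω} (hm : m ≤ m₀) (hm' : m' ≤ m₀)
    (h : Indep m m' P) {g : Ω → ℝ≥0∞} (hg : Measurable[m'] g) :
    condLExp m P g =ᵐ[P] fun _ => ∫⁻ x, g x ∂P := by
  refine (ae_eq_condLExp hm P g measurable_const fun s hs => ?_).symm
  have hone : Measurable[m] (s.indicator (1 : Ω → ℝ≥0∞)) :=
    Measurable.indicator (m := m) (@measurable_const _ _ _ m 1) hs
  calc ∫⁻ _ in s, ∫⁻ x, g x ∂P ∂P
    _ = (∫⁻ x, s.indicator 1 x ∂P) * ∫⁻ x, g x ∂P := by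
      rw [setLIntegral_const, mul_comm, lintegral_indicator_one (hm s hs)]
    _ = ∫⁻ x, s.indicator 1 x * g x ∂P :=
      (lintegral_mul_eq_lintegral_mul_lintegral_of_independent_measurableSpace hm hm' h hone
        hg).symm
    _ = ∫⁻ x in s, g x ∂P := by
      rw [← lintegral_indicator (hm s hs)]
      refine lintegral_congr fun x => ?_
      by_cases hx : x ∈ s <;> simp [hx]

end Independence

section Observations

variable {p : ℕ}

instance isProbabilityMeasure_obsLaw (m : Fin p → ℝ) : IsProbabilityMeasure (obsLaw m) := by
  unfold obsLaw; infer_instance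

/-- The law of independent observation vectors with the mean vectors `m 0, m 1, …`; it covers both
`P_∞` and `P_{μ,ν}`. -/
noncomputable def seqLaw (m : ℕ → Fin p → ℝ) : Measure (Obs p) :=
  Measure.infinitePi fun n => obsLaw (m n)

instance isProbabilityMeasure_seqLaw (m : ℕ → Fin p → ℝ) : IsProbabilityMeasure (seqLaw m) := by
  unfold seqLaw; infer_instance

theorem lawNoChange_eq_seqLaw (p : ℕ) : lawNoChange p = seqLaw fun _ => 0 := rfl

theorem lawChange_eq_seqLaw (μ : Fin p → ℝ) (ν : ℕ) :
    lawChange μ ν = seqLaw fun n => if ν ≤ n then μ else 0 := rfl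

instance isProbabilityMeasure_lawNoChange (p : ℕ) : IsProbabilityMeasure (lawNoChange p) :=
  isProbabilityMeasure_seqLaw _

instance isProbabilityMeasure_lawChange (μ : Fin p → ℝ) (ν : ℕ) :
    IsProbabilityMeasure (lawChange μ ν) :=
  isProbabilityMeasure_seqLaw _

theorem map_eval_seqLaw (m : ℕ → Fin p → ℝ) (n : ℕ) :
    (seqLaw m).map (fun x => x n) = obsLaw (m n) :=
  Measure.infinitePi_map_eval (fun n => obsLaw (m n)) n

theorem iIndepFun_eval_seqLaw (m : ℕ → Fin p → ℝ) :
    iIndepFun (fun n (x : Obs p) => x n) (seqLaw m) :=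
  iIndepFun_infinitePi (P := fun n => obsLaw (m n)) (X := fun _ y => y) fun _ => measurable_id

/-- The σ-algebra of the observations after time `n`. -/
abbrev futureInfo (p n : ℕ) : MeasurableSpace (Obs p) :=
  ⨆ i ∈ Set.Ioi n, MeasurableSpace.comap (fun x : Obs p => x i) inferInstance

theorem futureInfo_le (p n : ℕ) : futureInfo p n ≤ (inferInstance : MeasurableSpace (Obs p)) :=
  iSup₂_le fun i _ => (measurable_pi_apply i).comap_le

theorem indep_info_futureInfo (m : ℕ → Fin p → ℝ) (n : ℕ) :
    Indep (info p n) (futureInfo p n) (seqLaw m) :=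
  indep_iSup_of_disjoint (fun i => (measurable_pi_apply i).comap_le)
    (iIndepFun_eval_seqLaw m) (S := Finset.Icc 1 n) (T := Set.Ioi n)
    (Set.disjoint_left.2 fun _ hi hj => absurd (Finset.mem_Icc.1 hi).2 (not_le.2 hj))

theorem indep_info_comap_succ (m : ℕ → Fin p → ℝ) (n : ℕ) :
    Indep (info p n) (MeasurableSpace.comap (fun x : Obs p => x (n + 1)) inferInstance)
      (seqLaw m) :=
  indep_of_indep_of_le_right (indep_info_futureInfo m n)
    (le_iSup₂_of_le (n + 1) (Set.mem_Ioi.2 n.lt_succ_self) le_rfl)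

theorem measurable_eval_info {i n : ℕ} (h1 : 1 ≤ i) (hn : i ≤ n) :
    Measurable[info p n] fun x : Obs p => x i :=
  (comap_measurable _).mono (le_iSup₂_of_le (f := fun i (_ : i ∈ Finset.Icc 1 n) =>
    MeasurableSpace.comap (fun x : Obs p => x i) inferInstance) i
    (Finset.mem_Icc.2 ⟨h1, hn⟩) le_rfl) le_rfl

variable (c : ℝ) (ω : Fin p → ℝ)

theorem measurable_estimate (k : Fin p) {m l n : ℕ} (hm : 1 ≤ m) (hl : l ≤ n + 1) :
    Measurable[info p n] fun x : Obs p => estimate c ω x k m l := by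
  unfold estimate
  split_ifs
  · exact measurable_const
  · refine measurable_const.add (measurable_const.mul (Measurable.sub_const ?_ _))
    refine Measurable.div_const (Finset.measurable_sum _ fun i hi => ?_) _
    rw [Finset.mem_Ico] at hi
    exact (measurable_pi_apply k).comp (measurable_eval_info (by omega) (by omega))

theorem gaussianPDFReal_div_gaussianPDFReal_zero (a y : ℝ) :
    gaussianPDFReal a 1 y / gaussianPDFReal 0 1 y = Real.exp (a * y - a ^ 2 / 2) := by
  have hne : (√(2 * Real.pi * ((1 : NNReal) : ℝ)))⁻¹ ≠ 0 := by positivity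
  simp only [gaussianPDFReal_def]
  rw [mul_div_mul_left _ _ hne, ← Real.exp_sub]
  congr 1
  simp only [NNReal.coe_one]
  ring

theorem adapted_plugInLR {m : ℕ} (hm : 1 ≤ m) :
    Adapted (info p) fun n x => plugInLR c ω n m x := fun n => by
  simp only [plugInLR, gaussianPDFReal_div_gaussianPDFReal_zero]
  refine Finset.measurable_prod _ fun l hl => Finset.measurable_prod _ fun k _ => ?_
  rw [Finset.mem_Icc] at hl
  have hobs : Measurable[info p n] fun x : Obs p => x l k :=
    (measurable_pi_apply k).comp (measurable_eval_info (by omega) (by omega))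
  have hest : Measurable[info p n] fun x : Obs p => estimate c ω x k m l :=
    measurable_estimate c ω k hm (by omega)
  exact ((hest.mul hobs).sub ((hest.pow_const 2).div_const 2)).exp

theorem adapted_statistic : Adapted (info p) (statistic c ω) := fun n => by
  unfold statistic
  exact Finset.measurable_sum _ fun m hm => adapted_plugInLR c ω (Finset.mem_Icc.1 hm).1 n

theorem plugInLR_succ {n m : ℕ} (h : m ≤ n + 1) (x : Obs p) :
    plugInLR c ω (n + 1) m x = plugInLR c ω n m x *
      ∏ k, gaussianPDFReal (estimate c ω x k m (n + 1)) 1 (x (n + 1) k) /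
        gaussianPDFReal 0 1 (x (n + 1) k) := by
  unfold plugInLR
  rw [Finset.prod_Icc_succ_top h]

theorem plugInLR_pos (n m : ℕ) (x : Obs p) : 0 < plugInLR c ω n m x :=
  Finset.prod_pos fun _ _ => Finset.prod_pos fun _ _ =>
    div_pos (gaussianPDFReal_pos _ _ _ one_ne_zero) (gaussianPDFReal_pos _ _ _ one_ne_zero)

theorem plugInLR_self (n : ℕ) (x : Obs p) : plugInLR c ω n n x = 1 := by
  unfold plugInLR
  rw [Finset.Icc_self, Finset.prod_singleton]
  refine Finset.prod_eq_one fun k _ => ?_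
  rw [estimate, if_pos le_rfl]
  exact div_self (gaussianPDFReal_pos _ _ _ one_ne_zero).ne'

end Observations

section FalseAlarm

variable {p : ℕ}

theorem lintegral_obsLaw_zero_ratio (a : Fin p → ℝ) :
    ∫⁻ y, ENNReal.ofReal (∏ k, gaussianPDFReal (a k) 1 (y k) / gaussianPDFReal 0 1 (y k))
      ∂(obsLaw 0) = 1 := by
  simp only [gaussianPDFReal_div_gaussianPDFReal_zero, Real.exp_sub]
  have hone : ∀ k, ∫ t, Real.exp (a k * t) / Real.exp (a k ^ 2 / 2) ∂(gaussianReal 0 1) = 1 := by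
    intro k
    have hmgf := congrFun (mgf_fun_id_gaussianReal (μ := 0) (v := 1)) (a k)
    rw [mgf] at hmgf
    rw [integral_div, hmgf]
    simp
  have hint : Integrable (fun y : Fin p → ℝ => ∏ k, Real.exp (a k * y k) / Real.exp (a k ^ 2 / 2))
      (obsLaw 0) :=
    Integrable.fintype_prod (μ := fun k : Fin p => gaussianReal ((0 : Fin p → ℝ) k) 1)
      (f := fun k t => Real.exp (a k * t) / Real.exp (a k ^ 2 / 2))
      fun k => (integrable_exp_mul_gaussianReal _).div_const _
  rw [← ofReal_integral_eq_lintegral_ofReal hint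
    (Filter.Eventually.of_forall fun y => by positivity), obsLaw,
    integral_fintype_prod_eq_prod (μ := fun k : Fin p => gaussianReal ((0 : Fin p → ℝ) k) 1)
      (fun k t => Real.exp (a k * t) / Real.exp (a k ^ 2 / 2))]
  simp [hone]

variable (c : ℝ) (ω : Fin p → ℝ)

theorem setLIntegral_plugInLR_succ {n m : ℕ} (hm : m ∈ Finset.Icc 1 n) {A : Set (Obs p)}
    (hA : MeasurableSet[info p n] A) :
    ∫⁻ x in A, ENNReal.ofReal (plugInLR c ω (n + 1) m x) ∂(lawNoChange p)
      = ∫⁻ x in A, ENNReal.ofReal (plugInLR c ω n m x) ∂(lawNoChange p) := by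
  rw [Finset.mem_Icc] at hm
  set G : Obs p → ℝ≥0∞ := A.indicator fun x => ENNReal.ofReal (plugInLR c ω n m x) with hGdef
  set E : Obs p → Fin p → ℝ := fun x k => estimate c ω x k m (n + 1) with hEdef
  set R : (Fin p → ℝ) → (Fin p → ℝ) → ℝ≥0∞ := fun a y =>
    ENNReal.ofReal (∏ k, gaussianPDFReal (a k) 1 (y k) / gaussianPDFReal 0 1 (y k)) with hRdef
  have hGfin : ∀ x, G x ≠ ⊤ := fun x => by
    by_cases hx : x ∈ A <;> simp [hGdef, hx]
  have hR : Measurable fun q : (ℝ≥0∞ × (Fin p → ℝ)) × (Fin p → ℝ) => q.1.1 * R q.1.2 q.2 := by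
    simp only [hRdef, gaussianPDFReal_div_gaussianPDFReal_zero]
    fun_prop
  have hZ : Measurable[info p n] fun x => (G x, E x) :=
    (Measurable.indicator (m := info p n) (adapted_plugInLR c ω hm.1 n).ennreal_ofReal hA).prodMk
      (@measurable_pi_lambda _ _ _ (info p n) _ _ fun k => measurable_estimate c ω k hm.1 le_rfl)
  have hind : IndepFun (fun x => (G x, E x)) (fun x : Obs p => x (n + 1)) (lawNoChange p) :=
    indep_of_indep_of_le_left (indep_info_comap_succ _ n) hZ.comap_le
  rw [← lintegral_indicator ((info p).le n A hA), ← lintegral_indicator ((info p).le n A hA)]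
  calc ∫⁻ x, A.indicator (fun x => ENNReal.ofReal (plugInLR c ω (n + 1) m x)) x ∂(lawNoChange p)
    _ = ∫⁻ x, G x * R (E x) (x (n + 1)) ∂(lawNoChange p) := by
      refine lintegral_congr fun x => ?_
      by_cases hx : x ∈ A
      · simp only [hGdef, hRdef, hEdef, Set.indicator_of_mem hx]
        rw [plugInLR_succ c ω (by omega), ENNReal.ofReal_mul (plugInLR_pos c ω _ _ _).le]
      · simp only [hGdef, Set.indicator_of_notMem hx, zero_mul]
    _ = ∫⁻ x, ∫⁻ y, G x * R (E x) y ∂(obsLaw 0) ∂(lawNoChange p) := by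
      rw [lintegral_comp_prodMk_of_indepFun hind (hZ.mono ((info p).le n) le_rfl)
        (measurable_pi_apply _) hR, lawNoChange_eq_seqLaw, map_eval_seqLaw]
    _ = ∫⁻ x, G x ∂(lawNoChange p) := lintegral_congr fun x => by
      rw [lintegral_const_mul' _ _ (hGfin x), lintegral_obsLaw_zero_ratio, mul_one]

theorem setLIntegral_statistic_succ (n : ℕ) {A : Set (Obs p)} (hA : MeasurableSet[info p n] A) :
    ∫⁻ x in A, ENNReal.ofReal (statistic c ω (n + 1) x) ∂(lawNoChange p)
      = ∫⁻ x in A, ENNReal.ofReal (statistic c ω n x) ∂(lawNoChange p) + lawNoChange p A := by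
  have hsum : ∀ N M, ∫⁻ x in A, ENNReal.ofReal (∑ m ∈ Finset.Icc 1 M, plugInLR c ω N m x)
      ∂(lawNoChange p) = ∑ m ∈ Finset.Icc 1 M,
        ∫⁻ x in A, ENNReal.ofReal (plugInLR c ω N m x) ∂(lawNoChange p) := by
    intro N M
    rw [← lintegral_finsetSum' _ fun m hm => ((adapted_plugInLR c ω (Finset.mem_Icc.1 hm).1
      N).mono ((info p).le N) le_rfl).ennreal_ofReal.aemeasurable]
    exact lintegral_congr fun x =>
      ENNReal.ofReal_sum_of_nonneg fun m _ => (plugInLR_pos c ω _ _ _).le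
  unfold statistic
  rw [hsum, hsum, Finset.sum_Icc_succ_top (by omega),
    Finset.sum_congr rfl fun m hm => setLIntegral_plugInLR_succ c ω hm hA]
  simp [plugInLR_self]

theorem ofReal_le_avgRunLength_alarmTime (B : ℝ) :
    ENNReal.ofReal B ≤ avgRunLength (alarmTime c ω B) :=
  ofReal_le_lintegral_of_le_at_stop (F := info p) (u := statistic c ω)
    (measurableSet_lt_hittingAfter (adapted_statistic c ω) B 1) (fun _ _ => le_of_hittingAfter_eq)
    (fun _ => by simp [statistic]) fun n _ hA => (setLIntegral_statistic_succ c ω n hA).le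

end FalseAlarm

section DelayReduction

variable {p : ℕ} (c : ℝ) (ω : Fin p → ℝ)

/-- The observations from time `d` on, with time renumbered to start after `d`; it turns a change
at time `d + 1` into a change at time `1`. -/
def shift (p d : ℕ) (x : Obs p) : Obs p := fun n => x (n + d)

theorem measurable_shift (p d : ℕ) : Measurable (shift p d) :=
  measurable_pi_lambda _ fun _ => measurable_pi_apply _

theorem comap_shift_info_le (p d n : ℕ) : (info p n).comap (shift p d) ≤ futureInfo p d := by
  change (⨆ i ∈ Finset.Icc 1 n, MeasurableSpace.comap (fun x : Obs p => x i) inferInstance).comap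
    (shift p d) ≤ futureInfo p d
  simp only [MeasurableSpace.comap_iSup, MeasurableSpace.comap_comp]
  refine iSup₂_le fun i hi => le_iSup₂_of_le (i + d) ?_ le_rfl
  have := (Finset.mem_Icc.1 hi).1
  rw [Set.mem_Ioi]
  omega

theorem estimate_shift (d : ℕ) (x : Obs p) (k : Fin p) (m l : ℕ) :
    estimate c ω (shift p d x) k m l = estimate c ω x k (m + d) (l + d) := by
  have hsub : ((l + d : ℕ) : ℝ) - ((m + d : ℕ) : ℝ) = l - m := by push_cast; ring
  simp only [estimate, shift, add_le_add_iff_right, hsub,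
    ← Finset.sum_Ico_add' (fun i => x i k) m l d]

theorem plugInLR_shift (d n m : ℕ) (x : Obs p) :
    plugInLR c ω n m (shift p d x) = plugInLR c ω (n + d) (m + d) x := by
  simp only [plugInLR, estimate_shift, ← Finset.map_add_right_Icc, Finset.prod_map]
  rfl

theorem map_shift_lawChange (μ : Fin p → ℝ) (d : ℕ) :
    (lawChange μ (d + 1)).map (shift p d) = lawChange μ 1 := by
  have hmean : ∀ n, (if d + 1 ≤ n + d then μ else 0) = if 1 ≤ n then μ else 0 := fun n => by
    simp [add_comm d 1]
  simp only [lawChange, ← hmean]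
  exact Measure.map_infinitePi_infinitePi_of_inj
    (P := fun n : ℕ => obsLaw (if d + 1 ≤ n then μ else 0)) (f := fun n : ℕ => n + d)
    (add_left_injective d)

/-- The first time at which the likelihood ratio for a change at time `1` reaches `B`. -/
noncomputable def passageTime (B : ℝ) : Obs p → ℕ∞ :=
  hittingAfter (fun n x => plugInLR c ω n 1 x) (Set.Ici B) 1

theorem measurableSet_lt_passageTime (B : ℝ) (n : ℕ) :
    MeasurableSet[info p n] {x | (n : ℕ∞) < passageTime c ω B x} :=
  measurableSet_lt_hittingAfter (adapted_plugInLR c ω le_rfl) B 1 n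

theorem measurable_passageTime_shift (B : ℝ) (d : ℕ) :
    Measurable[futureInfo p d] fun x => (passageTime c ω B (shift p d x) : ℝ≥0∞) :=
  @measurable_toENNReal _ (futureInfo p d) _ fun n => comap_shift_info_le p d n _
    ⟨_, measurableSet_lt_passageTime c ω B n, rfl⟩

theorem lintegral_passageTime_shift (μ : Fin p → ℝ) (B : ℝ) (d : ℕ) :
    ∫⁻ x, (passageTime c ω B (shift p d x) : ℝ≥0∞) ∂(lawChange μ (d + 1))
      = ∫⁻ x, (passageTime c ω B x : ℝ≥0∞) ∂(lawChange μ 1) := by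
  rw [← map_shift_lawChange μ d, lintegral_map (measurable_toENNReal fun n =>
    (info p).le n _ (measurableSet_lt_passageTime c ω B n)) (measurable_shift p d)]

theorem alarmTime_le_passageTime_shift_add (B : ℝ) (d : ℕ) (x : Obs p) :
    alarmTime c ω B x ≤ passageTime c ω B (shift p d x) + d := by
  rcases eq_or_ne (passageTime c ω B (shift p d x)) ⊤ with h | h
  · rw [h, top_add]; exact le_top
  lift passageTime c ω B (shift p d x) to ℕ using h with t ht
  have ht1 : ((1 : ℕ) : ℕ∞) ≤ t := (le_hittingAfter (shift p d x)).trans_eq ht.symm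
  rw [Nat.cast_le] at ht1
  have hB : B ≤ plugInLR c ω (t + d) (1 + d) x :=
    (le_of_hittingAfter_eq ht.symm).trans_eq (plugInLR_shift c ω d t 1 x)
  have hstat : B ≤ statistic c ω (t + d) x :=
    hB.trans <| Finset.single_le_sum (f := fun m => plugInLR c ω (t + d) m x)
      (fun m _ => (plugInLR_pos c ω _ _ _).le) (Finset.mem_Icc.2 ⟨by omega, by omega⟩)
  exact_mod_cast (hittingAfter_le_of_mem (by omega) hstat : alarmTime c ω B x ≤ (t + d : ℕ))

theorem detectionDelay_alarmTime_le (μ : Fin p → ℝ) (B : ℝ) :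
    detectionDelay μ (alarmTime c ω B) ≤ ∫⁻ x, (passageTime c ω B x : ℝ≥0∞) ∂(lawChange μ 1) := by
  refine iSup₂_le fun ν hν => ?_
  obtain ⟨d, rfl⟩ : ∃ d, ν = d + 1 := ⟨ν - 1, by omega⟩
  have hle : ∀ x : Obs p, (alarmTime c ω B x : ℝ≥0∞) + 1 - ((d + 1 : ℕ) : ℝ≥0∞)
      ≤ (passageTime c ω B (shift p d x) : ℝ≥0∞) := fun x => by
    have hd : (alarmTime c ω B x : ℝ≥0∞) ≤ (passageTime c ω B (shift p d x) : ℝ≥0∞) + d := by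
      simpa using ENat.toENNReal_mono (alarmTime_le_passageTime_shift_add c ω B d x)
    rw [tsub_le_iff_right, Nat.cast_succ, ← add_assoc]
    gcongr
  have hcond := condLExp_ae_eq_lintegral_of_indep ((info p).le d) (futureInfo_le p d)
    (indep_info_futureInfo _ d : Indep _ _ (lawChange μ (d + 1)))
    (measurable_passageTime_shift c ω B d)
  have hmono := condLExp_mono (mΩ := info p d) (P := lawChange μ (d + 1))
    (Filter.Eventually.of_forall hle)
  refine essSup_le_of_ae_le _ (ae_restrict_of_ae ?_)
  filter_upwards [hcond, hmono] with x hx hxle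
  exact hxle.trans (hx.trans (lintegral_passageTime_shift c ω μ B d)).le

end DelayReduction

section Moments

theorem holderTriple_two_mul (q : ℕ) :
    ENNReal.HolderTriple ((2 * q : ℕ) : ℝ≥0∞) ((2 * q : ℕ) : ℝ≥0∞) (q : ℝ≥0∞) where
  inv_add_inv_eq_inv := by
    rw [← two_mul, Nat.cast_mul, ENNReal.mul_inv (by simp) (by simp), ← mul_assoc]
    simp [ENNReal.mul_inv_cancel]

variable {Ω : Type*} {mΩ : MeasurableSpace Ω} {P : Measure Ω} {f g : Ω → ℝ}

/-- Random variables all of whose moments are finite; they form an algebra on which every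
expectation below exists. -/
@[fun_prop]
def HasMoments (f : Ω → ℝ) (P : Measure Ω) : Prop := ∀ q : ℕ, MemLp f q P

namespace HasMoments

theorem integrable (hf : HasMoments f P) : Integrable f P := by
  simpa [memLp_one_iff_integrable] using hf 1

@[fun_prop]
theorem const [IsFiniteMeasure P] (a : ℝ) : HasMoments (fun _ => a) P := fun _ => memLp_const a

@[fun_prop]
theorem add (hf : HasMoments f P) (hg : HasMoments g P) : HasMoments (fun x => f x + g x) P :=
  fun q => (hf q).add (hg q)

@[fun_prop]
theorem sub (hf : HasMoments f P) (hg : HasMoments g P) : HasMoments (fun x => f x - g x) P :=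
  fun q => (hf q).sub (hg q)

@[fun_prop]
theorem neg (hf : HasMoments f P) : HasMoments (fun x => -f x) P := fun q => (hf q).neg

@[fun_prop]
theorem abs (hf : HasMoments f P) : HasMoments (fun x => |f x|) P := fun q => (hf q).norm

@[fun_prop]
theorem mul (hf : HasMoments f P) (hg : HasMoments g P) : HasMoments (fun x => f x * g x) P :=
  fun q => (hg (2 * q)).mul' (hpqr := holderTriple_two_mul q) (hf (2 * q))

@[fun_prop]
theorem pow [IsFiniteMeasure P] (hf : HasMoments f P) (n : ℕ) :
    HasMoments (fun x => f x ^ n) P := by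
  induction n with
  | zero => simpa using const 1
  | succ n ih => simpa only [pow_succ] using ih.mul hf

@[fun_prop]
theorem dotProduct {ι : Type*} [Fintype ι] {u v : Ω → ι → ℝ}
    (hu : ∀ i, HasMoments (fun x => u x i) P) (hv : ∀ i, HasMoments (fun x => v x i) P) :
    HasMoments (fun x => u x ⬝ᵥ v x) P :=
  fun q => memLp_finsetSum Finset.univ fun i _ => (hu i).mul (hv i) q

@[fun_prop]
theorem sum {ι : Type*} (s : Finset ι) {f : ι → Ω → ℝ} (hf : ∀ i, HasMoments (f i) P) :
    HasMoments (fun x => ∑ i ∈ s, f i x) P :=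
  fun q => memLp_finsetSum s fun i _ => hf i q

theorem indicator (hf : HasMoments f P) {A : Set Ω} (hA : MeasurableSet A) :
    HasMoments (A.indicator f) P :=
  fun q => (hf q).indicator hA

theorem lpNorm_mul_le (hf : HasMoments f P) (hg : HasMoments g P) (q : ℕ) :
    lpNorm (fun x => f x * g x) q P
      ≤ lpNorm f ((2 * q : ℕ) : ℝ≥0∞) P * lpNorm g ((2 * q : ℕ) : ℝ≥0∞) P := by
  have := holderTriple_two_mul q
  have hle := eLpNorm_smul_le_mul_eLpNorm (hg (2 * q)).aestronglyMeasurable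
    (hf (2 * q)).aestronglyMeasurable (p := ((2 * q : ℕ) : ℝ≥0∞)) (q := ((2 * q : ℕ) : ℝ≥0∞))
    (r := (q : ℝ≥0∞))
  rw [← toReal_eLpNorm (hf.mul hg q).aestronglyMeasurable,
    ← toReal_eLpNorm (hf (2 * q)).aestronglyMeasurable,
    ← toReal_eLpNorm (hg (2 * q)).aestronglyMeasurable, ← ENNReal.toReal_mul]
  exact ENNReal.toReal_mono (ENNReal.mul_ne_top (hf (2 * q)).eLpNorm_ne_top
    (hg (2 * q)).eLpNorm_ne_top) hle

theorem lpNorm_pow_eq_integral (hf : HasMoments f P) {q : ℕ} (hq : q ≠ 0) :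
    lpNorm f q P ^ q = ∫ x, |f x| ^ q ∂P := by
  rw [lpNorm_eq_integral_norm_rpow_toReal (by simpa) (by simp) (hf q).aestronglyMeasurable,
    ENNReal.toReal_natCast, Real.rpow_inv_natCast_pow (by positivity) hq]
  simp [Real.norm_eq_abs]

theorem integral_pow_le (hf : HasMoments f P) {q : ℕ} (hq : Even q) (hq0 : q ≠ 0) {C : ℝ}
    (h : lpNorm f q P ≤ C) : ∫ x, f x ^ q ∂P ≤ C ^ q := by
  calc ∫ x, f x ^ q ∂P
    _ = ∫ x, |f x| ^ q ∂P := by simp only [hq.pow_abs]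
    _ = lpNorm f q P ^ q := (hf.lpNorm_pow_eq_integral hq0).symm
    _ ≤ C ^ q := pow_le_pow_left₀ lpNorm_nonneg h q

end HasMoments

end Moments

section Gaussian

variable {Ω : Type*} {mΩ : MeasurableSpace Ω} {P : Measure Ω}

theorem hasLaw_sum_gaussianReal {ι : Type*} [IsProbabilityMeasure P] {X : ι → Ω → ℝ}
    {σ : ι → NNReal} (hX : ∀ i, Measurable (X i)) (hind : iIndepFun X P)
    (hlaw : ∀ i, HasLaw (X i) (gaussianReal 0 (σ i)) P) (s : Finset ι) :
    HasLaw (fun x => ∑ i ∈ s, X i x) (gaussianReal 0 (∑ i ∈ s, σ i)) P := by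
  classical
  refine ⟨by fun_prop, ?_⟩
  simp only [← Finset.sum_apply]
  induction s using Finset.induction_on with
  | empty => simp [gaussianReal_zero_var, Measure.map_const]
  | insert i s hi ih =>
    rw [Finset.sum_insert hi, Finset.sum_insert hi, gaussianReal_add_gaussianReal_of_indepFun
      (hind.indepFun_finsetSum_of_notMem hX hi).symm (hlaw i).map_eq ih, add_zero]

theorem hasMoments_id_gaussianReal (m : ℝ) (σ : NNReal) : HasMoments id (gaussianReal m σ) :=
  fun q => memLp_id_gaussianReal' q (by simp)

theorem HasMoments.of_hasLaw {Ω' : Type*} [MeasurableSpace Ω'] {Q : Measure Ω'} {X : Ω → Ω'}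
    {f : Ω' → ℝ} (hf : HasMoments f Q) (hX : HasLaw X Q P) : HasMoments (fun x => f (X x)) P :=
  fun q => (hX.map_eq ▸ hf q).comp_of_map hX.aemeasurable

variable {X : Ω → ℝ} {σ : NNReal}

theorem integral_sq_of_hasLaw_gaussianReal (hX : HasLaw X (gaussianReal 0 σ) P) :
    ∫ x, X x ^ 2 ∂P = σ := by
  have hvar := variance_fun_id_gaussianReal (μ := 0) (v := σ)
  rw [variance_of_integral_eq_zero (by fun_prop) integral_id_gaussianReal] at hvar
  rw [← hvar]
  exact hX.integral_comp (f := fun t => t ^ 2) (by fun_prop)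

theorem lpNorm_of_hasLaw_gaussianReal (hX : HasLaw X (gaussianReal 0 σ) P) (q : ℕ) :
    lpNorm X q P = √σ * lpNorm id q (gaussianReal 0 1) := by
  have hscale : gaussianReal 0 σ = (gaussianReal 0 1).map (√σ * ·) := by
    rw [gaussianReal_map_const_mul]
    congr 1
    · simp
    · ext; simp
  rw [← toReal_eLpNorm hX.aemeasurable.aestronglyMeasurable, ← Function.id_comp X,
    ← eLpNorm_map_measure (by fun_prop) hX.aemeasurable, hX.map_eq, hscale,
    eLpNorm_map_measure (by fun_prop) (by fun_prop), toReal_eLpNorm (by fun_prop)]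
  change lpNorm (√(σ : ℝ) • (id : ℝ → ℝ)) _ _ = _
  rw [lpNorm_const_smul, coe_nnnorm, Real.norm_of_nonneg (Real.sqrt_nonneg _)]

theorem integrable_exp_mul_of_hasLaw_gaussianReal (hX : HasLaw X (gaussianReal 0 σ) P) (t : ℝ) :
    Integrable (fun x => Real.exp (t * X x)) P :=
  (hX.map_eq ▸ integrable_exp_mul_gaussianReal t :
    Integrable (fun s => Real.exp (t * s)) (P.map X)).comp_aemeasurable hX.aemeasurable

theorem integral_exp_mul_of_hasLaw_gaussianReal (hX : HasLaw X (gaussianReal 0 σ) P) (t : ℝ) :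
    ∫ x, Real.exp (t * X x) ∂P = Real.exp (σ * t ^ 2 / 2) := by
  simpa [mgf] using mgf_gaussianReal hX.map_eq t

end Gaussian

section Noise

variable {p : ℕ} (μ : Fin p → ℝ)

/-- The centred observation vectors, numbered from `0`: after a change at time `1`, `noise μ i` is
the deviation of the observation at time `i + 1` from its mean. -/
def noise (i : ℕ) (x : Obs p) : Fin p → ℝ := x (i + 1) - μ

/-- The random walk with steps `noise μ 0, noise μ 1, …`. -/
def walk (n : ℕ) (x : Obs p) : Fin p → ℝ := ∑ i ∈ Finset.range n, noise μ i x

/-- The error of the sample mean of the observations at the times `1, …, n`; it is `0` for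
`n = 0`. -/
noncomputable def meanNoise (n : ℕ) (x : Obs p) : Fin p → ℝ := (n : ℝ)⁻¹ • walk μ n x

theorem dotProduct_walk (v : Fin p → ℝ) (n : ℕ) (x : Obs p) :
    v ⬝ᵥ walk μ n x = ∑ i ∈ Finset.range n, v ⬝ᵥ noise μ i x := by
  rw [walk, dotProduct_sum]

theorem measurable_dotProduct_noise (v : Fin p → ℝ) (i : ℕ) :
    Measurable[info p (i + 1)] fun x : Obs p => v ⬝ᵥ noise μ i x :=
  (Continuous.measurable (f := fun y : Fin p → ℝ => v ⬝ᵥ (y - μ)) (by fun_prop)).comp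
    (measurable_eval_info (Nat.le_add_left 1 i) le_rfl)

theorem measurable_walk (n : ℕ) : Measurable[info p n] (walk μ n) := by
  unfold walk noise
  refine Finset.measurable_sum _ fun i hi => ?_
  exact (measurable_eval_info (Nat.le_add_left 1 i)
    (Finset.mem_range.1 hi)).sub_const μ

theorem indep_info_dotProduct_noise (v : Fin p → ℝ) (i : ℕ) :
    Indep (info p i) (MeasurableSpace.comap (fun x : Obs p => v ⬝ᵥ noise μ i x) inferInstance)
      (lawChange μ 1) := by
  refine indep_of_indep_of_le_right (indep_info_comap_succ _ i) ?_
  change MeasurableSpace.comap ((fun y : Fin p → ℝ => v ⬝ᵥ (y - μ)) ∘ fun x : Obs p => x (i + 1)) _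
    ≤ _
  rw [← MeasurableSpace.comap_comp]
  exact MeasurableSpace.comap_mono
    (Continuous.measurable (f := fun y : Fin p → ℝ => v ⬝ᵥ (y - μ)) (by fun_prop)).comap_le

theorem iIndepFun_dotProduct_noise (v : Fin p → ℝ) :
    iIndepFun (fun i (x : Obs p) => v ⬝ᵥ noise μ i x) (lawChange μ 1) :=
  ((iIndepFun_eval_seqLaw _).precomp (add_left_injective 1)).comp
    (fun _ y => v ⬝ᵥ (y - μ)) fun _ => Continuous.measurable (by fun_prop)

theorem hasLaw_dotProduct_obsLaw (v : Fin p → ℝ) :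
    HasLaw (fun y => v ⬝ᵥ (y - μ)) (gaussianReal 0 (v ⬝ᵥ v).toNNReal) (obsLaw μ) := by
  have hcoord : ∀ k, HasLaw (fun y : Fin p → ℝ => v k * (y k - μ k))
      (gaussianReal 0 (v k * v k).toNNReal) (obsLaw μ) := fun k => by
    have heval : HasLaw (fun y : Fin p → ℝ => y k) (gaussianReal (μ k) 1) (obsLaw μ) :=
      (measurePreserving_eval (fun k => gaussianReal (μ k) 1) k).hasLaw
    convert! gaussianReal_const_mul (gaussianReal_sub_const heval (μ k)) (v k) using 2
    · simp
    · ext; simp [mul_self_nonneg, sq]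
  have hind : iIndepFun (fun k (y : Fin p → ℝ) => v k * (y k - μ k)) (obsLaw μ) :=
    iIndepFun_pi (X := fun k t => v k * (t - μ k)) fun k => by fun_prop
  have hvar : (v ⬝ᵥ v).toNNReal = ∑ k, (v k * v k).toNNReal :=
    Real.toNNReal_sum_of_nonneg fun k _ => mul_self_nonneg _
  rw [hvar]
  exact hasLaw_sum_gaussianReal (fun k => by fun_prop) hind hcoord Finset.univ

theorem hasLaw_dotProduct_noise (v : Fin p → ℝ) (i : ℕ) :
    HasLaw (fun x => v ⬝ᵥ noise μ i x) (gaussianReal 0 (v ⬝ᵥ v).toNNReal) (lawChange μ 1) := by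
  refine (hasLaw_dotProduct_obsLaw μ v).fun_comp ⟨(measurable_pi_apply _).aemeasurable, ?_⟩
  rw [lawChange_eq_seqLaw, map_eval_seqLaw, if_pos (Nat.le_add_left 1 i)]

theorem hasLaw_dotProduct_walk (v : Fin p → ℝ) (n : ℕ) :
    HasLaw (fun x => v ⬝ᵥ walk μ n x) (gaussianReal 0 (n * (v ⬝ᵥ v).toNNReal))
      (lawChange μ 1) := by
  simp_rw [dotProduct_walk]
  convert! hasLaw_sum_gaussianReal (fun i => (measurable_dotProduct_noise μ v i).mono
    ((info p).le _) le_rfl) (iIndepFun_dotProduct_noise μ v) (hasLaw_dotProduct_noise μ v)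
    (Finset.range n) using 2
  simp

variable {μ}

@[fun_prop]
theorem hasMoments_noise (i : ℕ) (k : Fin p) :
    HasMoments (fun x => noise μ i x k) (lawChange μ 1) := by
  simpa using (hasMoments_id_gaussianReal _ _).of_hasLaw
    (hasLaw_dotProduct_noise μ (Pi.single k 1) i)

@[fun_prop]
theorem hasMoments_walk (n : ℕ) (k : Fin p) :
    HasMoments (fun x => walk μ n x k) (lawChange μ 1) := by
  simp only [walk, Finset.sum_apply]
  fun_prop

@[fun_prop]
theorem hasMoments_meanNoise (n : ℕ) (k : Fin p) :
    HasMoments (fun x => meanNoise μ n x k) (lawChange μ 1) := by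
  simp only [meanNoise, Pi.smul_apply, smul_eq_mul]
  fun_prop

end Noise

section LogLikelihoodRatio

variable {p : ℕ} (c : ℝ) (ω μ : Fin p → ℝ)

theorem log_prod_gaussianPDFReal_div (a y : Fin p → ℝ) :
    Real.log (∏ k, gaussianPDFReal (a k) 1 (y k) / gaussianPDFReal 0 1 (y k))
      = a ⬝ᵥ y - a ⬝ᵥ a / 2 := by
  simp only [gaussianPDFReal_div_gaussianPDFReal_zero, ← Real.exp_sum, Real.log_exp,
    Finset.sum_sub_distrib, dotProduct, Finset.sum_div, sq]

theorem infoNumber_zero_right (θ : Fin p → ℝ) : infoNumber θ 0 μ = θ ⬝ᵥ μ - θ ⬝ᵥ θ / 2 := by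
  have hlaw := hasLaw_dotProduct_obsLaw μ θ
  have hcongr : ∀ y : Fin p → ℝ,
      ∑ k, Real.log (gaussianPDFReal (θ k) 1 (y k) / gaussianPDFReal ((0 : Fin p → ℝ) k) 1 (y k))
        = θ ⬝ᵥ (y - μ) + (θ ⬝ᵥ μ - θ ⬝ᵥ θ / 2) := fun y => by
    rw [← Real.log_prod fun k _ => (div_pos (gaussianPDFReal_pos _ _ _ one_ne_zero)
      (gaussianPDFReal_pos _ _ _ one_ne_zero)).ne', dotProduct_sub]
    simp only [Pi.zero_apply, log_prod_gaussianPDFReal_div]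
    ring
  have hint : Integrable (fun y => θ ⬝ᵥ (y - μ)) (obsLaw μ) :=
    ((hasMoments_id_gaussianReal _ _).of_hasLaw hlaw).integrable
  simp only [infoNumber, hcongr]
  rw [integral_add hint (integrable_const _), hlaw.integral_eq, integral_id_gaussianReal]
  simp

/-- The information number `I(μ*, 0; μ)`. -/
noncomputable abbrev infoStar : ℝ := infoNumber (muStar c ω μ) 0 μ

/-- The logarithm of the plug-in likelihood ratio for a change at time `1`. -/
noncomputable def logLR (n : ℕ) (x : Obs p) : ℝ := Real.log (plugInLR c ω n 1 x)

/-- The effect of the estimation error on one increment of `logLR`: the increment is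
`I + μ* ⬝ᵥ noise` if the estimator is replaced by its limit `μ*`. -/
noncomputable def remainder (n : ℕ) (x : Obs p) : ℝ :=
  c * (meanNoise μ n x ⬝ᵥ (μ - muStar c ω μ) + meanNoise μ n x ⬝ᵥ noise μ n x)
    - c ^ 2 / 2 * (meanNoise μ n x ⬝ᵥ meanNoise μ n x)

theorem estimate_one_succ {n : ℕ} (hn : 1 ≤ n) (x : Obs p) :
    (fun k => estimate c ω x k 1 (n + 1)) = muStar c ω μ + c • meanNoise μ n x := by
  have hn0 : (n : ℝ) ≠ 0 := by positivity
  ext k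
  have hsum : ∑ i ∈ Finset.range n, x (i + 1) k = walk μ n x k + n * μ k := by
    simp [walk, noise, Finset.sum_apply]
  simp only [estimate, if_neg (by omega : ¬n + 1 ≤ 1), Finset.sum_Ico_eq_sum_range,
    Nat.add_sub_cancel, add_comm 1, hsum, muStar, meanNoise, Pi.add_apply, Pi.smul_apply,
    smul_eq_mul]
  rw [Nat.cast_add, Nat.cast_one, add_sub_cancel_right]
  field_simp
  ring

theorem logLR_one (x : Obs p) : logLR c ω 1 x = 0 := by
  rw [logLR, plugInLR_self, Real.log_one]

theorem logLR_succ {n : ℕ} (hn : 1 ≤ n) (x : Obs p) :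
    logLR c ω (n + 1) x = logLR c ω n x
      + (infoStar c ω μ + muStar c ω μ ⬝ᵥ noise μ n x + remainder c ω μ n x) := by
  have hobs : x (n + 1) = μ + noise μ n x := by simp [noise]
  have hlog := log_prod_gaussianPDFReal_div (fun k => estimate c ω x k 1 (n + 1)) (x (n + 1))
  rw [infoStar, logLR, plugInLR_succ c ω (by omega), Real.log_mul (plugInLR_pos c ω n 1 x).ne'
    (Finset.prod_pos fun _ _ => div_pos (gaussianPDFReal_pos _ _ _ one_ne_zero)
      (gaussianPDFReal_pos _ _ _ one_ne_zero)).ne', ← logLR, hlog, estimate_one_succ c ω μ hn,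
    infoNumber_zero_right, remainder, hobs]
  simp only [add_dotProduct, dotProduct_add, dotProduct_sub, smul_dotProduct, dotProduct_smul,
    smul_eq_mul, dotProduct_comm (meanNoise μ n x) (muStar c ω μ)]
  ring

theorem remainder_zero (x : Obs p) : remainder c ω μ 0 x = 0 := by
  simp [remainder, meanNoise]

theorem logLR_eq {n : ℕ} (hn : 1 ≤ n) (x : Obs p) :
    logLR c ω n x = n * infoStar c ω μ + muStar c ω μ ⬝ᵥ walk μ n x
      + ∑ i ∈ Finset.range n, remainder c ω μ i x
      - (infoStar c ω μ + muStar c ω μ ⬝ᵥ noise μ 0 x) := by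
  induction n, hn using Nat.le_induction with
  | base => simp [logLR_one, dotProduct_walk, remainder_zero]
  | succ n hn ih =>
    rw [logLR_succ c ω μ hn, ih, dotProduct_walk, dotProduct_walk, Finset.sum_range_succ,
      Finset.sum_range_succ]
    push_cast
    ring

theorem measurable_logLR (n : ℕ) : Measurable[info p n] (logLR c ω n) :=
  Real.measurable_log.comp (adapted_plugInLR c ω le_rfl n)

@[fun_prop]
theorem hasMoments_remainder (n : ℕ) : HasMoments (remainder c ω μ n) (lawChange μ 1) := by
  unfold remainder
  fun_prop

end LogLikelihoodRatio

section StoppedSums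

theorem sum_range_inv_mul_sum_range (z : ℕ → ℝ) (h : ℝ) (n : ℕ) :
    ∑ l ∈ Finset.range n, (l : ℝ)⁻¹ * ∑ i ∈ Finset.range l, z i
      = ((harmonic (n - 1) : ℝ) - h) * ∑ i ∈ Finset.range n, z i
        - ∑ i ∈ Finset.range n, ((harmonic i : ℝ) - h) * z i := by
  induction n with
  | zero => simp
  | succ n ih =>
    rcases n with _ | n
    · simp
    rw [Finset.sum_range_succ, ih, Finset.sum_range_succ _ (n + 1),
      Finset.sum_range_succ _ (n + 1), Nat.add_sub_cancel, Nat.add_sub_cancel, harmonic_succ]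
    push_cast
    ring

theorem abs_harmonic_sub_le {a b m : ℕ} (hm : 1 ≤ m) (ha : m ≤ a) (hb : m ≤ b) :
    |(harmonic (a - 1) : ℝ) - harmonic (b - 1)| ≤ |(a : ℝ) - b| / m := by
  wlog hab : b ≤ a generalizing a b
  · rw [abs_sub_comm, abs_sub_comm (a : ℝ)]
    exact this hb ha (le_of_not_ge hab)
  induction a, hab using Nat.le_induction with
  | base => simp
  | succ n hbn ih =>
    obtain ⟨k, rfl⟩ : ∃ k, n = k + 1 := ⟨n - 1, by omega⟩
    have hinv : ((k + 1 : ℕ) : ℝ)⁻¹ ≤ 1 / m := by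
      rw [one_div]
      exact inv_anti₀ (by positivity) (by exact_mod_cast hb.trans hbn)
    have hbn' : (b : ℝ) ≤ (k + 1 : ℕ) := by exact_mod_cast hbn
    calc |(harmonic (k + 1 + 1 - 1) : ℝ) - harmonic (b - 1)|
      _ = |((harmonic (k + 1 - 1) : ℝ) - harmonic (b - 1)) + ((k + 1 : ℕ) : ℝ)⁻¹| := by
        rw [Nat.add_sub_cancel, Nat.add_sub_cancel, harmonic_succ]
        push_cast
        ring_nf
      _ ≤ |((k + 1 : ℕ) : ℝ) - b| / m + 1 / m := by
        refine (abs_add_le _ _).trans (add_le_add (ih (hb.trans hbn)) ?_)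
        rwa [abs_of_nonneg (by positivity)]
      _ = |((k + 1 + 1 : ℕ) : ℝ) - b| / m := by
        rw [abs_of_nonneg (by linarith), abs_of_nonneg (by push_cast at hbn' ⊢; linarith)]
        push_cast
        ring

variable {Ω : Type*} {mΩ : MeasurableSpace Ω} {P : Measure Ω} {F : Filtration ℕ mΩ} {τ : Ω → ℕ}
  {n : ℕ}

theorem sum_range_eq_sum_indicator (a : ℕ → Ω → ℝ) {x : Ω} (hn : τ x ≤ n) :
    ∑ j ∈ Finset.range (τ x), a j x
      = ∑ j ∈ Finset.range n, {y | j < τ y}.indicator (a j) x := by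
  rw [← Finset.sum_subset (Finset.range_mono hn) fun j _ hj =>
    Set.indicator_of_notMem (by simpa using hj) _]
  exact Finset.sum_congr rfl fun j hj => (Set.indicator_of_mem (by simpa using hj) (a j)).symm

theorem HasMoments.sum_range_comp {a : ℕ → Ω → ℝ} (ha : ∀ j, HasMoments (a j) P)
    (hτ : ∀ j, MeasurableSet[F j] {x | j < τ x}) (hn : ∀ x, τ x ≤ n) :
    HasMoments (fun x => ∑ j ∈ Finset.range (τ x), a j x) P := by
  simp only [fun x => sum_range_eq_sum_indicator a (hn x)]
  exact HasMoments.sum _ fun j => (ha j).indicator (F.le j _ (hτ j))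

theorem HasMoments.natCast_comp [IsFiniteMeasure P]
    (hτ : ∀ j, MeasurableSet[F j] {x | j < τ x}) (hn : ∀ x, τ x ≤ n) :
    HasMoments (fun x => (τ x : ℝ)) P := by
  simpa using HasMoments.sum_range_comp (fun _ => HasMoments.const 1) hτ hn

variable {ζ H : ℕ → Ω → ℝ}

/-- A centred sequence `ζ` adapted to the filtration `F` in the sense that `ζ j` is known at time
`j + 1` and is independent of the information at time `j`; its partial sums are a martingale. -/
structure IsInnovation (ζ : ℕ → Ω → ℝ) (F : Filtration ℕ mΩ) (P : Measure Ω) : Prop where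
  measurable : ∀ j, Measurable[F (j + 1)] (ζ j)
  indep : ∀ j, Indep (F j) (MeasurableSpace.comap (ζ j) inferInstance) P
  hasMoments : ∀ j, HasMoments (ζ j) P
  integral_eq_zero : ∀ j, ∫ x, ζ j x ∂P = 0

namespace IsInnovation

theorem measurable_sum_range (hζ : IsInnovation ζ F P) (j : ℕ) :
    Measurable[F j] fun x => ∑ i ∈ Finset.range j, ζ i x :=
  Finset.measurable_sum _ fun i hi =>
    (hζ.measurable i).mono (F.mono (Finset.mem_range.1 hi)) le_rfl

theorem integral_mul_eq_zero (hζ : IsInnovation ζ F P) {j : ℕ} {h : Ω → ℝ}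
    (hh : Measurable[F j] h) : ∫ x, h x * ζ j x ∂P = 0 := by
  have hind : IndepFun h (ζ j) P := indep_of_indep_of_le_left (hζ.indep j) hh.comap_le
  rw [hind.integral_fun_mul_eq_mul_integral (hh.mono (F.le j) le_rfl).aestronglyMeasurable
    (hζ.hasMoments j).integrable.aestronglyMeasurable, hζ.integral_eq_zero, mul_zero]

theorem integral_sum_range_mul_eq_zero (hζ : IsInnovation ζ F P)
    (hτ : ∀ j, MeasurableSet[F j] {x | j < τ x}) (hn : ∀ x, τ x ≤ n)
    (hHF : ∀ j, Measurable[F j] (H j)) (hH : ∀ j, HasMoments (H j) P) :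
    ∫ x, ∑ j ∈ Finset.range (τ x), H j x * ζ j x ∂P = 0 := by
  have hterm : ∀ j, ({x | j < τ x}.indicator fun x => H j x * ζ j x)
      = fun x => {y | j < τ y}.indicator (H j) x * ζ j x := fun j => by
    ext x; exact Set.indicator_mul_left _ _ _
  simp only [fun x => sum_range_eq_sum_indicator (fun j x => H j x * ζ j x) (hn x)]
  rw [integral_finsetSum _ fun j _ => (((hH j).mul (hζ.hasMoments j)).indicator
    (F.le j _ (hτ j))).integrable]
  refine Finset.sum_eq_zero fun j _ => ?_
  rw [hterm]
  exact hζ.integral_mul_eq_zero (Measurable.indicator (m := F j) (hHF j) (hτ j))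

variable [IsFiniteMeasure P]

theorem integral_sum_range_eq_zero (hζ : IsInnovation ζ F P)
    (hτ : ∀ j, MeasurableSet[F j] {x | j < τ x}) (hn : ∀ x, τ x ≤ n) :
    ∫ x, ∑ j ∈ Finset.range (τ x), ζ j x ∂P = 0 := by
  simpa using hζ.integral_sum_range_mul_eq_zero hτ hn (H := fun _ _ => 1)
    (fun _ => measurable_const) fun _ => HasMoments.const 1

theorem integral_sq_sum_range_le (hζ : IsInnovation ζ F P)
    (hτ : ∀ j, MeasurableSet[F j] {x | j < τ x}) (hn : ∀ x, τ x ≤ n) :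
    ∫ x, (∑ j ∈ Finset.range (τ x), ζ j x) ^ 2 ∂P
      ≤ ∑ j ∈ Finset.range n, ∫ x, ζ j x ^ 2 ∂P := by
  have hm := hζ.hasMoments
  have hsq : ∀ (z : ℕ → ℝ) (k : ℕ), (∑ j ∈ Finset.range k, z j) ^ 2
      = ∑ j ∈ Finset.range k, 2 * (∑ i ∈ Finset.range j, z i) * z j
        + ∑ j ∈ Finset.range k, z j ^ 2 := fun z k => by
    induction k with
    | zero => simp
    | succ k ih => rw [Finset.sum_range_succ, add_sq, ih, Finset.sum_range_succ,
        Finset.sum_range_succ]; ring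
  have hcross : HasMoments (fun x => ∑ j ∈ Finset.range (τ x),
      2 * (∑ i ∈ Finset.range j, ζ i x) * ζ j x) P :=
    HasMoments.sum_range_comp (fun j => by fun_prop) hτ hn
  have hsquares : HasMoments (fun x => ∑ j ∈ Finset.range n, ζ j x ^ 2) P := by fun_prop
  calc ∫ x, (∑ j ∈ Finset.range (τ x), ζ j x) ^ 2 ∂P
    _ ≤ ∫ x, (∑ j ∈ Finset.range (τ x), 2 * (∑ i ∈ Finset.range j, ζ i x) * ζ j x
          + ∑ j ∈ Finset.range n, ζ j x ^ 2) ∂P := by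
      refine integral_mono ((HasMoments.sum_range_comp hm hτ hn).pow 2).integrable
        (hcross.add hsquares).integrable fun x => ?_
      rw [hsq fun j => ζ j x]
      gcongr
      exact hn x
    _ = ∑ j ∈ Finset.range n, ∫ x, ζ j x ^ 2 ∂P := by
      rw [integral_add hcross.integrable hsquares.integrable,
        hζ.integral_sum_range_mul_eq_zero hτ hn
          (fun j => (hζ.measurable_sum_range j).const_mul 2) (fun j => by fun_prop), zero_add,
        integral_finsetSum _ fun j _ => ((hm j).pow 2).integrable]

/- Abel summation turns the sum into `(harmonic (τ - 1) - harmonic (r - 1)) * ∑ j < τ, ζ j` plus a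
stopped martingale; the sum itself would only be bounded in terms of a maximal inequality. -/
theorem abs_integral_sum_range_inv_mul_le (hζ : IsInnovation ζ F P)
    (hτ : ∀ j, MeasurableSet[F j] {x | j < τ x}) (hn : ∀ x, τ x ≤ n) {m r : ℕ} (hm : 1 ≤ m)
    (hmτ : ∀ x, m ≤ τ x) (hmr : m ≤ r) :
    |∫ x, ∑ l ∈ Finset.range (τ x), (l : ℝ)⁻¹ * ∑ i ∈ Finset.range l, ζ i x ∂P|
      ≤ (∫ x, ((τ x : ℝ) - r) ^ 2 ∂P + ∫ x, (∑ j ∈ Finset.range (τ x), ζ j x) ^ 2 ∂P) /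
          (2 * m) := by
  have hmom := hζ.hasMoments
  have hτm : HasMoments (fun x => (τ x : ℝ)) P := HasMoments.natCast_comp hτ hn
  have hS : HasMoments (fun x => ∑ j ∈ Finset.range (τ x), ζ j x) P :=
    HasMoments.sum_range_comp hmom hτ hn
  have hweighted : HasMoments (fun x => ∑ i ∈ Finset.range (τ x),
      ((harmonic i : ℝ) - harmonic (r - 1)) * ζ i x) P :=
    HasMoments.sum_range_comp (fun j => by fun_prop) hτ hn
  have hzero : ∫ x, ∑ i ∈ Finset.range (τ x),
      ((harmonic i : ℝ) - harmonic (r - 1)) * ζ i x ∂P = 0 :=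
    hζ.integral_sum_range_mul_eq_zero hτ hn (fun _ => measurable_const)
      fun _ => HasMoments.const _
  have hsum : HasMoments (fun x =>
      ∑ l ∈ Finset.range (τ x), (l : ℝ)⁻¹ * ∑ i ∈ Finset.range l, ζ i x) P :=
    HasMoments.sum_range_comp (fun j => by fun_prop) hτ hn
  have hm0 : (0 : ℝ) < m := by exact_mod_cast hm
  rw [← add_zero (∫ x, ∑ l ∈ Finset.range (τ x), (l : ℝ)⁻¹ * ∑ i ∈ Finset.range l, ζ i x ∂P),
    ← hzero, ← integral_add hsum.integrable hweighted.integrable, ← integral_add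
      ((hτm.sub (HasMoments.const (r : ℝ))).pow 2).integrable (hS.pow 2).integrable,
    ← integral_div]
  refine abs_integral_le_integral_abs.trans (integral_mono (hsum.add hweighted).abs.integrable
    (Integrable.div_const (by exact HasMoments.integrable (by fun_prop)) _) fun x => ?_)
  have hH := abs_harmonic_sub_le hm (hmτ x) hmr
  simp only [sum_range_inv_mul_sum_range (fun i => ζ i x) (harmonic (r - 1)), sub_add_cancel,
    abs_mul]
  set S := ∑ j ∈ Finset.range (τ x), ζ j x
  calc |(harmonic (τ x - 1) : ℝ) - harmonic (r - 1)| * |S|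
    _ ≤ |(τ x : ℝ) - r| / m * |S| := by gcongr
    _ ≤ (((τ x : ℝ) - r) ^ 2 + S ^ 2) / (2 * m) := by
      rw [div_mul_eq_mul_div, div_le_div_iff₀ hm0 (by positivity)]
      nlinarith [two_mul_le_add_sq |(τ x : ℝ) - r| |S|, sq_abs ((τ x : ℝ) - r), sq_abs S]

end IsInnovation

end StoppedSums

section MomentBounds

variable {p : ℕ} (c : ℝ) (ω μ : Fin p → ℝ)

theorem isInnovation_dotProduct_noise (v : Fin p → ℝ) :
    IsInnovation (fun i x => v ⬝ᵥ noise μ i x) (info p) (lawChange μ 1) where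
  measurable := measurable_dotProduct_noise μ v
  indep := indep_info_dotProduct_noise μ v
  hasMoments i := (hasMoments_id_gaussianReal _ _).of_hasLaw (hasLaw_dotProduct_noise μ v i)
  integral_eq_zero i := by
    rw [(hasLaw_dotProduct_noise μ v i).integral_eq, integral_id_gaussianReal]

theorem lpNorm_dotProduct_walk (v : Fin p → ℝ) (n q : ℕ) :
    lpNorm (fun x => v ⬝ᵥ walk μ n x) q (lawChange μ 1)
      = √n * (√(v ⬝ᵥ v) * lpNorm id q (gaussianReal 0 1)) := by
  have hv : 0 ≤ v ⬝ᵥ v := Finset.sum_nonneg fun k _ => mul_self_nonneg (v k)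
  rw [lpNorm_of_hasLaw_gaussianReal (hasLaw_dotProduct_walk μ v n)]
  simp [hv, mul_assoc]

theorem lpNorm_noise (i : ℕ) (k : Fin p) (q : ℕ) :
    lpNorm (fun x => noise μ i x k) q (lawChange μ 1) = lpNorm id q (gaussianReal 0 1) := by
  simpa using lpNorm_of_hasLaw_gaussianReal (hasLaw_dotProduct_noise μ (Pi.single k 1) i) q

theorem lpNorm_meanNoise (n : ℕ) (k : Fin p) (q : ℕ) :
    lpNorm (fun x => meanNoise μ n x k) q (lawChange μ 1)
      = (√n)⁻¹ * lpNorm id q (gaussianReal 0 1) := by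
  have hwalk := lpNorm_dotProduct_walk μ (Pi.single k 1) n q
  simp only [single_one_dotProduct, Pi.single_eq_same, Real.sqrt_one, one_mul] at hwalk
  change lpNorm ((n : ℝ)⁻¹ • fun x => walk μ n x k) _ _ = _
  rw [lpNorm_const_smul, coe_nnnorm, Real.norm_of_nonneg (by positivity), hwalk, ← mul_assoc]
  congr 1
  rcases n.eq_zero_or_pos with rfl | hn
  · simp
  · field_simp
    exact Real.sq_sqrt n.cast_nonneg

theorem lpNorm_meanNoise_dotProduct_le {q : ℕ} (hq : 1 ≤ q) {v : Obs p → Fin p → ℝ} {C : ℝ}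
    (hv : ∀ k, HasMoments (fun x => v x k) (lawChange μ 1))
    (hC : ∀ k, lpNorm (fun x => v x k) ((2 * q : ℕ) : ℝ≥0∞) (lawChange μ 1) ≤ C) (n : ℕ) :
    lpNorm (fun x => meanNoise μ n x ⬝ᵥ v x) q (lawChange μ 1)
      ≤ (√n)⁻¹ * (p * lpNorm id ((2 * q : ℕ) : ℝ≥0∞) (gaussianReal 0 1) * C) := by
  have hterm : ∀ k, HasMoments (fun x => meanNoise μ n x k * v x k) (lawChange μ 1) := fun k =>
    (hasMoments_meanNoise n k).mul (hv k)
  have hsum := lpNorm_sum_le (s := Finset.univ) (fun k _ => hterm k q) (by exact_mod_cast hq)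
  calc lpNorm (fun x => meanNoise μ n x ⬝ᵥ v x) q (lawChange μ 1)
    _ = lpNorm (∑ k, fun x => meanNoise μ n x k * v x k) q (lawChange μ 1) := by
      congr 1; ext x; simp [dotProduct]
    _ ≤ ∑ _k : Fin p, (√n)⁻¹ * lpNorm id ((2 * q : ℕ) : ℝ≥0∞) (gaussianReal 0 1) * C := by
      refine hsum.trans (Finset.sum_le_sum fun k _ => ?_)
      refine ((hasMoments_meanNoise n k).lpNorm_mul_le (hv k) q).trans ?_
      rw [lpNorm_meanNoise]
      exact mul_le_mul_of_nonneg_left (hC k) (mul_nonneg (by positivity) lpNorm_nonneg)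
    _ = _ := by
      rw [Finset.sum_const, Finset.card_univ, Fintype.card_fin, nsmul_eq_mul]
      ring

theorem inv_sqrt_natCast_le_one (n : ℕ) : (√(n : ℝ))⁻¹ ≤ 1 := by
  rcases n.eq_zero_or_pos with rfl | hn
  · simp
  · exact inv_le_one_of_one_le₀ (Real.one_le_sqrt.2 (by exact_mod_cast hn))

theorem exists_lpNorm_remainder_le {q : ℕ} (hq : 1 ≤ q) :
    ∃ C, ∀ n : ℕ, lpNorm (remainder c ω μ n) q (lawChange μ 1) ≤ (√n)⁻¹ * C := by
  set κ := lpNorm id ((2 * q : ℕ) : ℝ≥0∞) (gaussianReal 0 1)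
  set gap := μ - muStar c ω μ
  have hq' : (1 : ℝ≥0∞) ≤ q := by exact_mod_cast hq
  have hgap := lpNorm_meanNoise_dotProduct_le μ hq (v := fun _ => gap) (C := ‖gap‖)
    (fun k => HasMoments.const _) fun k => by
      rw [lpNorm_const (by simp; omega) (NeZero.ne _)]
      simpa using norm_le_pi_norm gap k
  have hnoise := fun n => lpNorm_meanNoise_dotProduct_le μ hq (v := noise μ n) (C := κ)
    (hasMoments_noise n) (fun k => (lpNorm_noise μ n k _).le) n
  have hsquare := fun n => lpNorm_meanNoise_dotProduct_le μ hq (v := meanNoise μ n) (C := κ)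
    (hasMoments_meanNoise n) (fun k => (lpNorm_meanNoise μ n k _).trans_le
      (mul_le_of_le_one_left lpNorm_nonneg (inv_sqrt_natCast_le_one n))) n
  refine ⟨|c| * (p * κ * ‖gap‖ + p * κ * κ) + c ^ 2 / 2 * (p * κ * κ), fun n => ?_⟩
  have hlinear : HasMoments (fun x => meanNoise μ n x ⬝ᵥ gap) (lawChange μ 1) := by fun_prop
  have hcross : HasMoments (fun x => meanNoise μ n x ⬝ᵥ noise μ n x) (lawChange μ 1) := by fun_prop
  have hadd := lpNorm_add_le (hlinear q) (g := fun x => meanNoise μ n x ⬝ᵥ noise μ n x) hq'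
  have hsub := lpNorm_sub_le (((hlinear q).add (hcross q)).const_smul c)
    (g := (c ^ 2 / 2) • fun x => meanNoise μ n x ⬝ᵥ meanNoise μ n x) hq'
  rw [lpNorm_const_smul, lpNorm_const_smul, coe_nnnorm, coe_nnnorm, Real.norm_eq_abs,
    Real.norm_of_nonneg (by positivity)] at hsub
  calc lpNorm (remainder c ω μ n) q (lawChange μ 1)
    _ ≤ |c| * ((√n)⁻¹ * (p * κ * ‖gap‖) + (√n)⁻¹ * (p * κ * κ))
        + c ^ 2 / 2 * ((√n)⁻¹ * (p * κ * κ)) := by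
      refine hsub.trans ?_
      gcongr
      · exact hadd.trans (add_le_add (hgap n) (hnoise n))
      · exact hsquare n
    _ = _ := by ring

theorem sum_range_inv_sqrt_le (n : ℕ) : ∑ j ∈ Finset.range n, (√(j : ℝ))⁻¹ ≤ 2 * √n := by
  rcases n with _ | n
  · simp
  refine le_trans ?_ (mul_le_mul_of_nonneg_left (Real.sqrt_le_sqrt (Nat.cast_le.2 n.le_succ))
    zero_le_two)
  induction n with
  | zero => simp
  | succ n ih =>
    have hsqrt := Real.mul_self_sqrt (n.cast_nonneg : (0 : ℝ) ≤ n)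
    have hsqrt' := Real.mul_self_sqrt ((n + 1).cast_nonneg : (0 : ℝ) ≤ (n + 1 : ℕ))
    have hstep : (√((n + 1 : ℕ) : ℝ))⁻¹ ≤ 2 * √((n + 1 : ℕ) : ℝ) - 2 * √n := by
      rw [inv_le_iff_one_le_mul₀ (by positivity)]
      push_cast at hsqrt' ⊢
      nlinarith [sq_nonneg (√((n : ℝ) + 1) - √n)]
    rw [Finset.sum_range_succ]
    linarith

theorem exists_lpNorm_sum_abs_remainder_le {q : ℕ} (hq : 1 ≤ q) :
    ∃ C, ∀ n : ℕ, lpNorm (fun x => ∑ i ∈ Finset.range n, |remainder c ω μ i x|) q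
      (lawChange μ 1) ≤ √n * C := by
  obtain ⟨C, hC⟩ := exists_lpNorm_remainder_le c ω μ hq
  have hC0 : 0 ≤ C := by simpa using lpNorm_nonneg.trans (hC 1)
  refine ⟨2 * C, fun n => ?_⟩
  have hmem : ∀ i ∈ Finset.range n, MemLp |remainder c ω μ i| q (lawChange μ 1) := fun i _ =>
    (hasMoments_remainder c ω μ i).abs q
  calc lpNorm (fun x => ∑ i ∈ Finset.range n, |remainder c ω μ i x|) q (lawChange μ 1)
    _ = lpNorm (∑ i ∈ Finset.range n, |remainder c ω μ i|) q (lawChange μ 1) := by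
      congr 1; ext x; simp
    _ ≤ ∑ i ∈ Finset.range n, (√i)⁻¹ * C := by
      refine (lpNorm_sum_le hmem (by exact_mod_cast hq)).trans (Finset.sum_le_sum fun i _ => ?_)
      rw [lpNorm_abs (hasMoments_remainder c ω μ i q).aestronglyMeasurable]
      exact hC i
    _ ≤ √n * (2 * C) := by
      rw [← Finset.sum_mul]
      nlinarith [sum_range_inv_sqrt_le n]

@[fun_prop]
theorem hasMoments_logLR (n : ℕ) : HasMoments (logLR c ω n) (lawChange μ 1) := by
  rcases n.eq_zero_or_pos with rfl | hn
  · have hzero : logLR c ω 0 = fun _ => 0 := by ext x; simp [logLR, plugInLR]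
    exact hzero ▸ HasMoments.const 0
  · rw [funext (logLR_eq c ω μ hn)]
    fun_prop

theorem exists_lpNorm_logLR_sub_le {q : ℕ} (hq : 1 ≤ q) :
    ∃ C, ∀ n : ℕ, 1 ≤ n →
      lpNorm (fun x => logLR c ω n x - n * infoStar c ω μ) q (lawChange μ 1)
        ≤ √n * C := by
  obtain ⟨C, hC⟩ := exists_lpNorm_sum_abs_remainder_le c ω μ hq
  set θ := muStar c ω μ
  set I := infoStar c ω μ
  have hq' : (1 : ℝ≥0∞) ≤ q := by exact_mod_cast hq
  have hwalk := fun n => lpNorm_dotProduct_walk μ θ n q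
  set κ := √(θ ⬝ᵥ θ) * lpNorm id q (gaussianReal 0 1)
  refine ⟨κ + C + lpNorm (fun x => I + θ ⬝ᵥ noise μ 0 x) q (lawChange μ 1), fun n hn => ?_⟩
  have hwalkm : HasMoments (fun x => θ ⬝ᵥ walk μ n x) (lawChange μ 1) := by fun_prop
  have habs : HasMoments (fun x => ∑ i ∈ Finset.range n, |remainder c ω μ i x|)
    (lawChange μ 1) := by fun_prop
  have hsum : HasMoments (fun x => ∑ i ∈ Finset.range n, remainder c ω μ i x)
    (lawChange μ 1) := by fun_prop
  have hsqrt : 1 ≤ √(n : ℝ) := Real.one_le_sqrt.2 (by exact_mod_cast hn)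
  have hle : lpNorm (fun x => ∑ i ∈ Finset.range n, remainder c ω μ i x) q (lawChange μ 1)
      ≤ √n * C :=
    (lpNorm_mono_real (habs q) fun x => Finset.abs_sum_le_sum_abs _ _).trans (hC n)
  calc lpNorm (fun x => logLR c ω n x - n * I) q (lawChange μ 1)
    _ = lpNorm ((fun x => θ ⬝ᵥ walk μ n x) + (fun x => ∑ i ∈ Finset.range n, remainder c ω μ i x)
          - fun x => I + θ ⬝ᵥ noise μ 0 x) q (lawChange μ 1) := by
      congr 1; ext x
      simp only [logLR_eq c ω μ hn, Pi.sub_apply, Pi.add_apply]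
      ring
    _ ≤ √n * κ + √n * C + lpNorm (fun x => I + θ ⬝ᵥ noise μ 0 x) q (lawChange μ 1) := by
      refine (lpNorm_sub_le ((hwalkm q).add (hsum q)) hq').trans ?_
      gcongr
      exact (lpNorm_add_le (hwalkm q) hq').trans (add_le_add (hwalk n).le hle)
    _ ≤ _ := by
      rw [mul_add, mul_add]
      gcongr
      exact le_mul_of_one_le_left lpNorm_nonneg hsqrt

theorem exists_integral_remainder_pow_le :
    ∃ C, ∀ n : ℕ, ∫ x, remainder c ω μ n x ^ 4 ∂lawChange μ 1 ≤ C / n ^ 2 := by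
  obtain ⟨C, hC⟩ := exists_lpNorm_remainder_le c ω μ (q := 4) (by norm_num)
  refine ⟨C ^ 4, fun n => ?_⟩
  convert (hasMoments_remainder c ω μ n).integral_pow_le (by decide) four_ne_zero (hC n) using 1
  rw [mul_pow, inv_pow, show √(n : ℝ) ^ 4 = (√n ^ 2) ^ 2 by ring, Real.sq_sqrt n.cast_nonneg]
  ring

theorem exists_integral_sq_sum_abs_remainder_le :
    ∃ C, ∀ n : ℕ, ∫ x, (∑ i ∈ Finset.range n, |remainder c ω μ i x|) ^ 2 ∂lawChange μ 1
      ≤ C * n := by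
  obtain ⟨C, hC⟩ := exists_lpNorm_sum_abs_remainder_le c ω μ (q := 2) (by norm_num)
  refine ⟨C ^ 2, fun n => ?_⟩
  convert HasMoments.integral_pow_le (by fun_prop) (by decide) two_ne_zero (hC n) using 1
  rw [mul_pow, Real.sq_sqrt n.cast_nonneg, mul_comm]

theorem exists_integral_logLR_sub_pow_le :
    ∃ C, ∀ n : ℕ, 1 ≤ n →
      ∫ x, (logLR c ω n x - n * infoStar c ω μ) ^ 4 ∂lawChange μ 1
        ≤ C * n ^ 2 := by
  obtain ⟨C, hC⟩ := exists_lpNorm_logLR_sub_le c ω μ (q := 4) (by norm_num)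
  refine ⟨C ^ 4, fun n hn => ?_⟩
  convert HasMoments.integral_pow_le (by fun_prop) (by decide) four_ne_zero (hC n hn) using 1
  rw [mul_pow, show √(n : ℝ) ^ 4 = (√n ^ 2) ^ 2 by ring, Real.sq_sqrt n.cast_nonneg, mul_comm]

end MomentBounds

section WindowTime

variable {p : ℕ} (c : ℝ) (ω μ : Fin p → ℝ) (b : ℝ) (m : ℕ)

/-- The first time in `[m, 8 * m]` at which `logLR` has reached the level `b`, and `8 * m` if there
is none. -/
noncomputable def windowTime (x : Obs p) : ℕ :=
  hittingBtwn (logLR c ω) (Set.Ici b) m (8 * m) x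

theorem windowTime_le (x : Obs p) : windowTime c ω b m x ≤ 8 * m := hittingBtwn_le x

theorem le_windowTime (x : Obs p) : m ≤ windowTime c ω b m x := le_hittingBtwn (by omega) x

theorem measurableSet_lt_windowTime (j : ℕ) :
    MeasurableSet[info p j] {x | j < windowTime c ω b m x} := by
  have hadapted : Adapted (info p) (logLR c ω) := measurable_logLR c ω
  simpa [windowTime] using
    (hadapted.isStoppingTime_hittingBtwn measurableSet_Ici).measurableSet_gt j

variable {c ω b m}

theorem logLR_lt_of_lt_windowTime {j : ℕ} {x : Obs p} (hm : m ≤ j)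
    (hj : j < windowTime c ω b m x) : logLR c ω j x < b :=
  not_le.1 (notMem_of_lt_hittingBtwn hj hm)

theorem le_logLR_windowTime {x : Obs p} (h : windowTime c ω b m x < 8 * m) :
    b ≤ logLR c ω (windowTime c ω b m x) x :=
  hittingBtwn_mem_set_of_hittingBtwn_lt h

variable {x : Obs p} {N : ℕ}

theorem abs_dotProduct_noise_le {i : ℕ} (hi : i < N) (v : Fin p → ℝ) :
    |v ⬝ᵥ noise μ i x| ≤ √(∑ j ∈ Finset.range N, (v ⬝ᵥ noise μ j x) ^ 2) :=
  Real.abs_le_sqrt (Finset.single_le_sum (f := fun j => (v ⬝ᵥ noise μ j x) ^ 2)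
    (fun _ _ => sq_nonneg _) (Finset.mem_range.2 hi))

theorem abs_logLR_sub_le {n : ℕ} (hn : 1 ≤ n) (hnN : n ≤ N) :
    |logLR c ω n x - n * infoStar c ω μ - ∑ i ∈ Finset.range n, muStar c ω μ ⬝ᵥ noise μ i x|
      ≤ √(∑ i ∈ Finset.range N, (muStar c ω μ ⬝ᵥ noise μ i x) ^ 2)
        + ∑ i ∈ Finset.range N, |remainder c ω μ i x| + |infoStar c ω μ| := by
  have hrem : |∑ i ∈ Finset.range n, remainder c ω μ i x|
      ≤ ∑ i ∈ Finset.range N, |remainder c ω μ i x| :=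
    (Finset.abs_sum_le_sum_abs _ _).trans (Finset.sum_le_sum_of_subset_of_nonneg
      (Finset.range_mono hnN) fun _ _ _ => abs_nonneg _)
  have hinit := abs_dotProduct_noise_le (x := x) μ (hn.trans hnN) (muStar c ω μ)
  calc _ = |∑ i ∈ Finset.range n, remainder c ω μ i x
          - (infoStar c ω μ + muStar c ω μ ⬝ᵥ noise μ 0 x)| := by
        rw [logLR_eq c ω μ hn, dotProduct_walk]
        ring_nf
    _ ≤ |∑ i ∈ Finset.range n, remainder c ω μ i x|
          + (|infoStar c ω μ| + |muStar c ω μ ⬝ᵥ noise μ 0 x|) :=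
        (abs_sub _ _).trans (add_le_add_right (abs_add_le _ _) _)
    _ ≤ _ := by linarith

theorem mul_abs_windowTime_sub_le (hI : 0 < infoStar c ω μ) (hm : 1 ≤ m)
    (hb : 2 * infoStar c ω μ * m ≤ b) (hb' : b ≤ 2 * infoStar c ω μ * (m + 1)) :
    infoStar c ω μ * |(windowTime c ω b m x : ℝ) - 2 * m|
      ≤ |∑ i ∈ Finset.range (windowTime c ω b m x), muStar c ω μ ⬝ᵥ noise μ i x|
        + 2 * √(∑ i ∈ Finset.range (8 * m), (muStar c ω μ ⬝ᵥ noise μ i x) ^ 2)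
        + ∑ i ∈ Finset.range (8 * m), |remainder c ω μ i x| + 4 * infoStar c ω μ := by
  have hdev := fun n (hn : 1 ≤ n) (hn' : n ≤ 8 * m) =>
    abs_le.1 (abs_logLR_sub_le (c := c) (ω := ω) (x := x) μ hn hn')
  rw [abs_of_pos hI] at hdev
  have hstep := fun i (hi : i < 8 * m) =>
    (abs_le.1 (abs_dotProduct_noise_le (x := x) μ hi (muStar c ω μ))).2
  have hmτ : m ≤ windowTime c ω b m x := le_windowTime c ω b m x
  have hτm : windowTime c ω b m x ≤ 8 * m := windowTime_le c ω b m x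
  have hover := le_logLR_windowTime (c := c) (ω := ω) (b := b) (m := m) (x := x)
  have hbefore := fun j => logLR_lt_of_lt_windowTime (c := c) (ω := ω) (b := b) (m := m) (j := j)
    (x := x)
  generalize windowTime c ω b m x = τ at *
  set I := infoStar c ω μ
  set R := ∑ i ∈ Finset.range (8 * m), (muStar c ω μ ⬝ᵥ noise μ i x) ^ 2
  set Q := ∑ i ∈ Finset.range (8 * m), |remainder c ω μ i x|
  set W := fun n => ∑ i ∈ Finset.range n, muStar c ω μ ⬝ᵥ noise μ i x
  have hQ : 0 ≤ Q := Finset.sum_nonneg fun _ _ => abs_nonneg _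
  have hR := Real.sqrt_nonneg R
  have hW := abs_le.1 (le_refl |W τ|)
  have hIm : 0 ≤ I * m := by positivity
  rw [← abs_of_pos hI, ← abs_mul, abs_of_pos hI, abs_le]
  constructor
  · rcases hτm.lt_or_eq with hlt | rfl
    · linarith [hover hlt, (hdev τ (hm.trans hmτ) hτm).2]
    · push_cast
      linarith
  · rcases hmτ.eq_or_lt with rfl | hlt
    · linarith
    · obtain ⟨j, rfl⟩ : ∃ j, τ = j + 1 := ⟨τ - 1, by omega⟩
      have hWj : W (j + 1) = W j + muStar c ω μ ⬝ᵥ noise μ j x := Finset.sum_range_succ _ _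
      push_cast
      linarith [hbefore j (by omega) (by omega), hstep j (by omega),
        (hdev j (by omega) (by omega)).1]

end WindowTime

section WindowTimeMoments

variable {p : ℕ} {c : ℝ} {ω : Fin p → ℝ} {b : ℝ} {m : ℕ} (μ : Fin p → ℝ)

theorem integral_sq_dotProduct_noise (v : Fin p → ℝ) (i : ℕ) :
    ∫ x, (v ⬝ᵥ noise μ i x) ^ 2 ∂lawChange μ 1 = v ⬝ᵥ v := by
  rw [integral_sq_of_hasLaw_gaussianReal (hasLaw_dotProduct_noise μ v i), Real.coe_toNNReal]
  exact Finset.sum_nonneg fun k _ => mul_self_nonneg (v k)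

theorem integral_sq_sum_range_windowTime_le (v : Fin p → ℝ) :
    ∫ x, (∑ i ∈ Finset.range (windowTime c ω b m x), v ⬝ᵥ noise μ i x) ^ 2 ∂lawChange μ 1
      ≤ 8 * (v ⬝ᵥ v) * m := by
  refine ((isInnovation_dotProduct_noise μ v).integral_sq_sum_range_le
    (measurableSet_lt_windowTime c ω b m) (windowTime_le c ω b m)).trans_eq ?_
  simp only [integral_sq_dotProduct_noise, Finset.sum_const, Finset.card_range, nsmul_eq_mul]
  push_cast
  ring

@[fun_prop]
theorem hasMoments_windowTime :
    HasMoments (fun x => (windowTime c ω b m x : ℝ)) (lawChange μ 1) :=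
  HasMoments.natCast_comp (measurableSet_lt_windowTime c ω b m) (windowTime_le c ω b m)

theorem hasMoments_sum_range_windowTime {a : ℕ → Obs p → ℝ}
    (ha : ∀ j, HasMoments (a j) (lawChange μ 1)) :
    HasMoments (fun x => ∑ j ∈ Finset.range (windowTime c ω b m x), a j x) (lawChange μ 1) :=
  HasMoments.sum_range_comp ha (measurableSet_lt_windowTime c ω b m) (windowTime_le c ω b m)

theorem sq_windowTime_sub_le {x : Obs p} (hI : 0 < infoStar c ω μ) (hm : 1 ≤ m)
    (hb : 2 * infoStar c ω μ * m ≤ b) (hb' : b ≤ 2 * infoStar c ω μ * (m + 1)) :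
    ((windowTime c ω b m x : ℝ) - (2 * m : ℕ)) ^ 2 ≤ 4 / infoStar c ω μ ^ 2
      * ((∑ i ∈ Finset.range (windowTime c ω b m x), muStar c ω μ ⬝ᵥ noise μ i x) ^ 2
        + 4 * ∑ i ∈ Finset.range (8 * m), (muStar c ω μ ⬝ᵥ noise μ i x) ^ 2
        + (∑ i ∈ Finset.range (8 * m), |remainder c ω μ i x|) ^ 2 + 16 * infoStar c ω μ ^ 2) := by
  have hdev := pow_le_pow_left₀ (by positivity)
    (mul_abs_windowTime_sub_le (x := x) μ hI hm hb hb') 2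
  have hR := Real.sq_sqrt (Finset.sum_nonneg fun i (_ : i ∈ Finset.range (8 * m)) =>
    sq_nonneg (muStar c ω μ ⬝ᵥ noise μ i x))
  rw [mul_pow, sq_abs] at hdev
  rw [← hR, ← sq_abs (∑ i ∈ Finset.range (windowTime c ω b m x), _), div_mul_eq_mul_div,
    le_div_iff₀' (by positivity), Nat.cast_mul, Nat.cast_two]
  refine hdev.trans ?_
  generalize |∑ i ∈ Finset.range (windowTime c ω b m x), muStar c ω μ ⬝ᵥ noise μ i x| = w
  generalize √(∑ i ∈ Finset.range (8 * m), (muStar c ω μ ⬝ᵥ noise μ i x) ^ 2) = r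
  generalize ∑ i ∈ Finset.range (8 * m), |remainder c ω μ i x| = s
  nlinarith [sq_nonneg (w - 2 * r), sq_nonneg (w - s), sq_nonneg (w - 4 * infoStar c ω μ),
    sq_nonneg (2 * r - s), sq_nonneg (2 * r - 4 * infoStar c ω μ),
    sq_nonneg (s - 4 * infoStar c ω μ)]

theorem exists_integral_sq_windowTime_sub_le (hI : 0 < infoStar c ω μ) :
    ∃ C, ∀ m : ℕ, 1 ≤ m → ∀ b, 2 * infoStar c ω μ * m ≤ b → b ≤ 2 * infoStar c ω μ * (m + 1) →
      ∫ x, ((windowTime c ω b m x : ℝ) - (2 * m : ℕ)) ^ 2 ∂lawChange μ 1 ≤ C * m := by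
  obtain ⟨C, hC⟩ := exists_integral_sq_sum_abs_remainder_le c ω μ
  set I := infoStar c ω μ
  set θ := muStar c ω μ
  refine ⟨4 / I ^ 2 * (8 * (θ ⬝ᵥ θ) + 4 * (8 * (θ ⬝ᵥ θ)) + 8 * C + 16 * I ^ 2),
    fun m hm b hb hb' => ?_⟩
  set W := fun x => ∑ i ∈ Finset.range (windowTime c ω b m x), θ ⬝ᵥ noise μ i x
  set R := fun x : Obs p => ∑ i ∈ Finset.range (8 * m), (θ ⬝ᵥ noise μ i x) ^ 2
  set Q := fun x => ∑ i ∈ Finset.range (8 * m), |remainder c ω μ i x|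
  have hWm : HasMoments W (lawChange μ 1) := hasMoments_sum_range_windowTime μ fun j => by fun_prop
  have hRm : HasMoments R (lawChange μ 1) := by fun_prop
  have hQm : HasMoments Q (lawChange μ 1) := by fun_prop
  have hER : ∫ x, R x ∂lawChange μ 1 = 8 * (θ ⬝ᵥ θ) * m := by
    rw [integral_finsetSum _ fun i _ => by exact HasMoments.integrable (by fun_prop)]
    simp only [integral_sq_dotProduct_noise, Finset.sum_const, Finset.card_range, nsmul_eq_mul]
    push_cast
    ring
  have hEQ := hC (8 * m)
  have hEW := integral_sq_sum_range_windowTime_le (c := c) (ω := ω) (b := b) (m := m) μ θ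
  calc ∫ x, ((windowTime c ω b m x : ℝ) - (2 * m : ℕ)) ^ 2 ∂lawChange μ 1
    _ ≤ ∫ x, 4 / I ^ 2 * (W x ^ 2 + 4 * R x + Q x ^ 2 + 16 * I ^ 2) ∂lawChange μ 1 :=
      integral_mono (by exact HasMoments.integrable (by fun_prop))
        (by exact HasMoments.integrable (by fun_prop)) fun x => sq_windowTime_sub_le μ hI hm hb hb'
    _ = 4 / I ^ 2 * (∫ x, W x ^ 2 ∂lawChange μ 1 + 4 * (8 * (θ ⬝ᵥ θ) * m)
          + ∫ x, Q x ^ 2 ∂lawChange μ 1 + 16 * I ^ 2) := by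
      rw [integral_const_mul, integral_add, integral_add, integral_add, integral_const_mul, hER]
      · simp
      all_goals exact HasMoments.integrable (by fun_prop)
    _ ≤ 4 / I ^ 2 * (8 * (θ ⬝ᵥ θ) + 4 * (8 * (θ ⬝ᵥ θ)) + 8 * C + 16 * I ^ 2) * m := by
      have hIm : 16 * I ^ 2 ≤ 16 * I ^ 2 * m :=
        le_mul_of_one_le_right (by positivity) (by exact_mod_cast hm)
      push_cast at hEQ
      rw [mul_assoc (4 / I ^ 2)]
      exact mul_le_mul_of_nonneg_left (by linarith) (by positivity)

end WindowTimeMoments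

section EstimationCost

variable {p : ℕ} {c : ℝ} {ω : Fin p → ℝ} {b : ℝ} {m : ℕ} (μ : Fin p → ℝ)

theorem exists_abs_integral_sum_meanNoise_dotProduct_le (hI : 0 < infoStar c ω μ)
    (v : Fin p → ℝ) :
    ∃ C, ∀ m : ℕ, 1 ≤ m → ∀ b, 2 * infoStar c ω μ * m ≤ b → b ≤ 2 * infoStar c ω μ * (m + 1) →
      |∫ x, ∑ l ∈ Finset.range (windowTime c ω b m x), meanNoise μ l x ⬝ᵥ v ∂lawChange μ 1|
        ≤ C := by
  obtain ⟨C, hC⟩ := exists_integral_sq_windowTime_sub_le μ hI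
  refine ⟨(C + 8 * (v ⬝ᵥ v)) / 2, fun m hm b hb hb' => ?_⟩
  have : (0 : ℝ) < m := by exact_mod_cast hm
  have hmean : ∀ l x, meanNoise μ l x ⬝ᵥ v
      = (l : ℝ)⁻¹ * ∑ i ∈ Finset.range l, v ⬝ᵥ noise μ i x := fun l x => by
    rw [meanNoise, smul_dotProduct, smul_eq_mul, dotProduct_comm, dotProduct_walk]
  simp only [hmean]
  refine ((isInnovation_dotProduct_noise μ v).abs_integral_sum_range_inv_mul_le
    (measurableSet_lt_windowTime c ω b m) (windowTime_le c ω b m) hm (le_windowTime c ω b m)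
    (by omega : m ≤ 2 * m)).trans ?_
  rw [div_le_iff₀ (by positivity)]
  linarith [hC m hm b hb hb', integral_sq_sum_range_windowTime_le (c := c) (ω := ω) (b := b)
    (m := m) μ v]

theorem integral_sum_meanNoise_dotProduct_noise :
    ∫ x, ∑ l ∈ Finset.range (windowTime c ω b m x), meanNoise μ l x ⬝ᵥ noise μ l x
      ∂lawChange μ 1 = 0 := by
  simp only [dotProduct]
  simp_rw [Finset.sum_comm (s := Finset.range _)]
  rw [integral_finsetSum _ fun k _ => (hasMoments_sum_range_windowTime μ fun j => by
    fun_prop).integrable]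
  refine Finset.sum_eq_zero fun k _ => ?_
  have hinnov := isInnovation_dotProduct_noise μ (Pi.single k 1)
  simp only [single_one_dotProduct] at hinnov
  refine hinnov.integral_sum_range_mul_eq_zero (measurableSet_lt_windowTime c ω b m)
    (windowTime_le c ω b m) (H := fun l x => meanNoise μ l x k) (fun l => ?_) fun l => by fun_prop
  exact ((measurable_pi_apply k).comp (measurable_walk μ l)).const_mul _

theorem integral_meanNoise_dotProduct_self (l : ℕ) :
    ∫ x, meanNoise μ l x ⬝ᵥ meanNoise μ l x ∂lawChange μ 1 = p * (l : ℝ)⁻¹ := by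
  have hcoord : ∀ k, ∫ x, walk μ l x k ^ 2 ∂lawChange μ 1 = l := fun k => by
    have hlaw := hasLaw_dotProduct_walk μ (Pi.single k 1) l
    simp only [single_one_dotProduct] at hlaw
    rw [integral_sq_of_hasLaw_gaussianReal hlaw]
    simp
  have hexpand : ∀ x : Obs p, meanNoise μ l x ⬝ᵥ meanNoise μ l x
      = ∑ k, ((l : ℝ)⁻¹) ^ 2 * walk μ l x k ^ 2 := fun x =>
    Finset.sum_congr rfl fun k _ => by simp only [meanNoise, Pi.smul_apply, smul_eq_mul]; ring
  simp only [hexpand]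
  rw [integral_finsetSum _ fun k _ => by exact HasMoments.integrable (by fun_prop)]
  simp only [integral_const_mul, hcoord, Finset.sum_const, Finset.card_univ, Fintype.card_fin,
    nsmul_eq_mul]
  rcases eq_or_ne (l : ℝ) 0 with hl | hl
  · simp [hl]
  · field_simp

theorem sum_range_inv_le_one_add_log (n : ℕ) :
    ∑ l ∈ Finset.range n, (l : ℝ)⁻¹ ≤ 1 + Real.log n := by
  rcases n with _ | n
  · simp
  rw [Finset.sum_range_succ']
  have h := harmonic_le_one_add_log n
  rw [harmonic] at h
  push_cast at h ⊢
  have hmono : Real.log n ≤ Real.log (n + 1) := by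
    rcases n.eq_zero_or_pos with rfl | hn
    · simp
    · exact Real.log_le_log (by exact_mod_cast hn) (by linarith)
  simpa using h.trans (by gcongr)

theorem integral_sum_meanNoise_dotProduct_self_le :
    ∫ x, ∑ l ∈ Finset.range (windowTime c ω b m x), meanNoise μ l x ⬝ᵥ meanNoise μ l x
      ∂lawChange μ 1 ≤ p * (1 + Real.log (8 * m : ℕ)) := by
  have hself : ∀ l (x : Obs p), 0 ≤ meanNoise μ l x ⬝ᵥ meanNoise μ l x := fun l x =>
    Finset.sum_nonneg fun k _ => mul_self_nonneg _
  calc ∫ x, ∑ l ∈ Finset.range (windowTime c ω b m x), meanNoise μ l x ⬝ᵥ meanNoise μ l x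
          ∂lawChange μ 1
    _ ≤ ∫ x, ∑ l ∈ Finset.range (8 * m), meanNoise μ l x ⬝ᵥ meanNoise μ l x ∂lawChange μ 1 :=
      integral_mono (hasMoments_sum_range_windowTime μ fun j => by fun_prop).integrable
        (by exact HasMoments.integrable (by fun_prop)) fun x =>
        Finset.sum_le_sum_of_subset_of_nonneg
          (Finset.range_mono (windowTime_le c ω b m x)) fun l _ _ => hself l x
    _ = p * ∑ l ∈ Finset.range (8 * m), (l : ℝ)⁻¹ := by
      rw [integral_finsetSum _ fun l _ => by exact HasMoments.integrable (by fun_prop),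
        Finset.mul_sum]
      simp only [integral_meanNoise_dotProduct_self]
    _ ≤ p * (1 + Real.log (8 * m : ℕ)) := by
      gcongr
      exact sum_range_inv_le_one_add_log _

theorem exists_neg_integral_sum_remainder_le (hI : 0 < infoStar c ω μ) :
    ∃ C, ∀ m : ℕ, 1 ≤ m → ∀ b, 2 * infoStar c ω μ * m ≤ b → b ≤ 2 * infoStar c ω μ * (m + 1) →
      -∫ x, ∑ l ∈ Finset.range (windowTime c ω b m x), remainder c ω μ l x ∂lawChange μ 1
        ≤ p * c ^ 2 / 2 * Real.log m + C := by
  obtain ⟨C, hC⟩ := exists_abs_integral_sum_meanNoise_dotProduct_le μ hI (μ - muStar c ω μ)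
  refine ⟨|c| * C + p * c ^ 2 / 2 * (1 + Real.log 8), fun m hm b hb hb' => ?_⟩
  have hlin := (neg_le_abs _).trans ((abs_mul c _).trans_le
    (mul_le_mul_of_nonneg_left (hC m hm b hb hb') (abs_nonneg c)))
  have hquad := mul_le_mul_of_nonneg_left (integral_sum_meanNoise_dotProduct_self_le (c := c)
    (ω := ω) (b := b) (m := m) μ) (by positivity : 0 ≤ c ^ 2 / 2)
  rw [Nat.cast_mul, Real.log_mul (by norm_num) (by positivity), Nat.cast_ofNat] at hquad
  simp only [remainder, Finset.sum_sub_distrib, ← Finset.mul_sum, Finset.sum_add_distrib]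
  rw [integral_sub, integral_const_mul, integral_const_mul, integral_add,
    integral_sum_meanNoise_dotProduct_noise, add_zero]
  · linarith
  all_goals refine HasMoments.integrable ?_
  · exact hasMoments_sum_range_windowTime μ fun j => by fun_prop
  · exact hasMoments_sum_range_windowTime μ fun j => by fun_prop
  · exact .mul (.const _) (.add (hasMoments_sum_range_windowTime μ fun j => by fun_prop)
      (hasMoments_sum_range_windowTime μ fun j => by fun_prop))
  · exact .mul (.const _) (hasMoments_sum_range_windowTime μ fun j => by fun_prop)

end EstimationCost

section Overshoot

theorem le_log_card_add_sum_exp_div {ι : Type*} {s : Finset ι} {i : ι} (hi : i ∈ s) (f : ι → ℝ) :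
    f i ≤ Real.log s.card + (∑ j ∈ s, Real.exp (f j)) / s.card := by
  have hcard : (0 : ℝ) < s.card := by exact_mod_cast Finset.card_pos.2 ⟨i, hi⟩
  have hle : Real.exp (f i) ≤ ∑ j ∈ s, Real.exp (f j) :=
    Finset.single_le_sum (f := fun j => Real.exp (f j)) (fun _ _ => (Real.exp_pos _).le) hi
  have hpos : 0 < ∑ j ∈ s, Real.exp (f j) := (Real.exp_pos _).trans_le hle
  calc f i ≤ Real.log (∑ j ∈ s, Real.exp (f j)) := (Real.le_log_iff_exp_le hpos).2 hle
    _ = Real.log s.card + Real.log ((∑ j ∈ s, Real.exp (f j)) / s.card) := by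
      rw [Real.log_div hpos.ne' hcard.ne']
      ring
    _ ≤ Real.log s.card + (∑ j ∈ s, Real.exp (f j)) / s.card := by
      gcongr
      linarith [Real.log_le_sub_one_of_pos (div_pos hpos hcard)]

theorem le_add_pow_four_div {a : ℝ} (ha : 0 < a) (d : ℝ) : d ≤ a + d ^ 4 / a ^ 3 := by
  rw [← sub_le_iff_le_add', le_div_iff₀ (by positivity)]
  nlinarith [sq_nonneg (d ^ 2 - a ^ 2), sq_nonneg (a * (d - a)), sq_nonneg (a * d)]

variable {p : ℕ} {c : ℝ} {ω : Fin p → ℝ} {b : ℝ} {m : ℕ} (μ : Fin p → ℝ)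

theorem logLR_windowTime_eq (hm : 1 ≤ m) (x : Obs p) :
    logLR c ω (windowTime c ω b m x) x = windowTime c ω b m x * infoStar c ω μ
      + ∑ i ∈ Finset.range (windowTime c ω b m x), muStar c ω μ ⬝ᵥ noise μ i x
      + ∑ i ∈ Finset.range (windowTime c ω b m x), remainder c ω μ i x
      - (infoStar c ω μ + muStar c ω μ ⬝ᵥ noise μ 0 x) := by
  rw [logLR_eq c ω μ (hm.trans (le_windowTime c ω b m x)), dotProduct_walk]

theorem hasMoments_logLR_windowTime (hm : 1 ≤ m) :
    HasMoments (fun x => logLR c ω (windowTime c ω b m x) x) (lawChange μ 1) := by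
  simp only [logLR_windowTime_eq μ hm]
  have hsum := hasMoments_sum_range_windowTime (c := c) (ω := ω) (b := b) (m := m) μ
    (a := fun i x => muStar c ω μ ⬝ᵥ noise μ i x) fun j => by fun_prop
  have hrem := hasMoments_sum_range_windowTime (c := c) (ω := ω) (b := b) (m := m) μ
    (hasMoments_remainder c ω μ)
  fun_prop

/- If the level is reached at once, then `logLR m` exceeds its mean by at least `I * m`; otherwise
the excess is at most the last increment, whose Gaussian part is bounded by a soft maximum. -/
theorem logLR_windowTime_le (hI : 0 < infoStar c ω μ) (hm : 1 ≤ m)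
    (hb : 2 * infoStar c ω μ * m ≤ b) {η : ℝ} (hη : 0 < η) (x : Obs p) :
    logLR c ω (windowTime c ω b m x) x ≤ b
      + (logLR c ω m x - m * infoStar c ω μ) ^ 4 / (m * infoStar c ω μ) ^ 3
      + (infoStar c ω μ + 1 + ∑ i ∈ Finset.Ico m (8 * m), remainder c ω μ i x ^ 4
        + η * (Real.log (8 * m : ℕ) + (∑ i ∈ Finset.range (8 * m),
          Real.exp (η⁻¹ * (muStar c ω μ ⬝ᵥ noise μ i x))) / (8 * m : ℕ))) := by
  set I := infoStar c ω μ
  have hIm : 0 < m * I := mul_pos (by exact_mod_cast hm) hI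
  have hrem : 0 ≤ ∑ i ∈ Finset.Ico m (8 * m), remainder c ω μ i x ^ 4 :=
    Finset.sum_nonneg fun i _ => by positivity
  rcases (le_windowTime c ω b m x).eq_or_lt with hmτ | hmτ
  · rw [← hmτ]
    have hmax : 0 ≤ η * (Real.log (8 * m : ℕ) + (∑ i ∈ Finset.range (8 * m),
        Real.exp (η⁻¹ * (muStar c ω μ ⬝ᵥ noise μ i x))) / (8 * m : ℕ)) :=
      mul_nonneg hη.le (add_nonneg (Real.log_natCast_nonneg _)
        (div_nonneg (Finset.sum_nonneg fun _ _ => (Real.exp_pos _).le) (Nat.cast_nonneg _)))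
    linarith [le_add_pow_four_div hIm (logLR c ω m x - m * I)]
  · obtain ⟨j, hj⟩ : ∃ j, windowTime c ω b m x = j + 1 := ⟨windowTime c ω b m x - 1, by omega⟩
    have hj8 : j < 8 * m := by have := windowTime_le c ω b m x; omega
    have hbefore : logLR c ω j x < b :=
      logLR_lt_of_lt_windowTime (m := m) (by omega) (by omega)
    have hdev : 0 ≤ (logLR c ω m x - m * I) ^ 4 / (m * I) ^ 3 :=
      div_nonneg (by positivity) (pow_nonneg hIm.le 3)
    have hremj : remainder c ω μ j x ^ 4 ≤ ∑ i ∈ Finset.Ico m (8 * m), remainder c ω μ i x ^ 4 :=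
      Finset.single_le_sum (f := fun i => remainder c ω μ i x ^ 4) (fun i _ => by positivity)
        (Finset.mem_Ico.2 ⟨by omega, hj8⟩)
    have hmax := le_log_card_add_sum_exp_div (Finset.mem_range.2 hj8)
      fun i => η⁻¹ * (muStar c ω μ ⬝ᵥ noise μ i x)
    rw [Finset.card_range, inv_mul_le_iff₀ hη] at hmax
    rw [hj, logLR_succ c ω μ (by omega : 1 ≤ j)]
    linarith [le_add_pow_four_div one_pos (remainder c ω μ j x)]

theorem integral_logLR_sub_pow_div_le {C : ℝ} (hI : 0 < infoStar c ω μ) (hm : 1 ≤ m)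
    (hC : ∫ x, (logLR c ω m x - m * infoStar c ω μ) ^ 4 ∂lawChange μ 1 ≤ C * m ^ 2) :
    ∫ x, (logLR c ω m x - m * infoStar c ω μ) ^ 4 / (m * infoStar c ω μ) ^ 3 ∂lawChange μ 1
      ≤ C / infoStar c ω μ ^ 3 := by
  have hm1 : (1 : ℝ) ≤ m := by exact_mod_cast hm
  have hC0 : 0 ≤ C := by
    have h0 : 0 ≤ ∫ x, (logLR c ω m x - m * infoStar c ω μ) ^ 4 ∂lawChange μ 1 :=
      integral_nonneg fun x => by positivity
    exact nonneg_of_mul_nonneg_left (h0.trans hC) (by positivity)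
  rw [integral_div, div_le_div_iff₀ (by positivity) (by positivity), mul_pow]
  calc _ ≤ C * m ^ 2 * infoStar c ω μ ^ 3 := by gcongr
    _ ≤ C * m ^ 3 * infoStar c ω μ ^ 3 := by gcongr; norm_num
    _ = _ := by ring

theorem exists_integral_sum_remainder_pow_le (c : ℝ) (ω μ : Fin p → ℝ) :
    ∃ C, ∀ m : ℕ, 1 ≤ m →
      ∫ x, ∑ i ∈ Finset.Ico m (8 * m), remainder c ω μ i x ^ 4 ∂lawChange μ 1 ≤ C := by
  obtain ⟨C, hC⟩ := exists_integral_remainder_pow_le c ω μ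
  have hC0 : 0 ≤ C := by
    simpa using (integral_nonneg fun x => by positivity).trans (hC 1)
  refine ⟨7 * C, fun m hm => ?_⟩
  have hm1 : (1 : ℝ) ≤ m := by exact_mod_cast hm
  rw [integral_finsetSum _ fun i _ => by exact HasMoments.integrable (by fun_prop)]
  calc ∑ i ∈ Finset.Ico m (8 * m), ∫ x, remainder c ω μ i x ^ 4 ∂lawChange μ 1
    _ ≤ (Finset.Ico m (8 * m)).card • (C / m ^ 2) := Finset.sum_le_card_nsmul _ _ _ fun i hi =>
      (hC i).trans (by gcongr; exact (Finset.mem_Ico.1 hi).1)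
    _ = 7 * C / m := by
      rw [Nat.card_Ico, show 8 * m - m = 7 * m by omega, nsmul_eq_mul]
      push_cast
      field_simp
    _ ≤ 7 * C := div_le_self (by positivity) hm1

theorem integral_sum_exp_dotProduct_noise_div (v : Fin p → ℝ) (t : ℝ) {n : ℕ} (hn : n ≠ 0) :
    ∫ x, (∑ i ∈ Finset.range n, Real.exp (t * (v ⬝ᵥ noise μ i x))) / n ∂lawChange μ 1
      = Real.exp ((v ⬝ᵥ v).toNNReal * t ^ 2 / 2) := by
  rw [integral_div, integral_finsetSum _ fun i _ =>
    integrable_exp_mul_of_hasLaw_gaussianReal (hasLaw_dotProduct_noise μ v i) t]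
  simp only [integral_exp_mul_of_hasLaw_gaussianReal (hasLaw_dotProduct_noise μ v _),
    Finset.sum_const, Finset.card_range, nsmul_eq_mul]
  exact mul_div_cancel_left₀ _ (by exact_mod_cast hn)

theorem exists_integral_logLR_windowTime_le (hI : 0 < infoStar c ω μ) {η : ℝ} (hη : 0 < η) :
    ∃ C, ∀ m : ℕ, 1 ≤ m → ∀ b, 2 * infoStar c ω μ * m ≤ b →
      ∫ x, logLR c ω (windowTime c ω b m x) x ∂lawChange μ 1 ≤ b + η * Real.log m + C := by
  obtain ⟨C, hC⟩ := exists_integral_logLR_sub_pow_le c ω μ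
  obtain ⟨C', hC'⟩ := exists_integral_sum_remainder_pow_le c ω μ
  set I := infoStar c ω μ
  set θ := muStar c ω μ
  refine ⟨C / I ^ 3 + (I + 1 + C' + η * (Real.log 8
    + Real.exp ((θ ⬝ᵥ θ).toNNReal * η⁻¹ ^ 2 / 2))), fun m hm b hb => ?_⟩
  have hm8 : 8 * m ≠ 0 := by omega
  set Dev := fun x => (logLR c ω m x - m * I) ^ 4 / (m * I) ^ 3
  set Rem := fun x => ∑ i ∈ Finset.Ico m (8 * m), remainder c ω μ i x ^ 4
  set Avg := fun x => (∑ i ∈ Finset.range (8 * m), Real.exp (η⁻¹ * (θ ⬝ᵥ noise μ i x)))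
    / (8 * m : ℕ)
  have hDev : Integrable Dev (lawChange μ 1) :=
    (HasMoments.integrable (f := fun x => (logLR c ω m x - m * I) ^ 4) (by fun_prop)).div_const _
  have hRem : Integrable Rem (lawChange μ 1) := by exact HasMoments.integrable (by fun_prop)
  have hAvg : Integrable Avg (lawChange μ 1) := (integrable_finsetSum _ fun i _ =>
    integrable_exp_mul_of_hasLaw_gaussianReal (hasLaw_dotProduct_noise μ θ i) _).div_const _
  have hlog : Real.log (8 * m : ℕ) = Real.log 8 + Real.log m := by
    rw [Nat.cast_mul, Real.log_mul (by norm_num) (by positivity), Nat.cast_ofNat]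
  calc ∫ x, logLR c ω (windowTime c ω b m x) x ∂lawChange μ 1
    _ ≤ ∫ x, (b + Dev x + (I + 1 + Rem x + η * (Real.log (8 * m : ℕ) + Avg x)))
          ∂lawChange μ 1 :=
      integral_mono (hasMoments_logLR_windowTime μ hm).integrable (by fun_prop)
        (logLR_windowTime_le μ hI hm hb hη)
    _ = b + ∫ x, Dev x ∂lawChange μ 1 + (I + 1 + ∫ x, Rem x ∂lawChange μ 1
          + η * (Real.log (8 * m : ℕ) + ∫ x, Avg x ∂lawChange μ 1)) := by
      rw [integral_add, integral_add, integral_add, integral_add (f := fun _ => I + 1),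
        integral_const_mul, integral_add (f := fun _ => Real.log (8 * m : ℕ))]
      · simp
      all_goals fun_prop
    _ ≤ b + η * Real.log m + (C / I ^ 3 + (I + 1 + C' + η * (Real.log 8
          + Real.exp ((θ ⬝ᵥ θ).toNNReal * η⁻¹ ^ 2 / 2)))) := by
      rw [hlog, integral_sum_exp_dotProduct_noise_div μ θ η⁻¹ hm8]
      linarith [integral_logLR_sub_pow_div_le μ hI hm (hC m hm), hC' m hm]

end Overshoot

section PassageTime

variable {p : ℕ} {c : ℝ} {ω : Fin p → ℝ} (μ : Fin p → ℝ)

theorem exists_mul_integral_windowTime_le (hI : 0 < infoStar c ω μ) {η : ℝ} (hη : 0 < η) :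
    ∃ C, ∀ m : ℕ, 1 ≤ m → ∀ b, 2 * infoStar c ω μ * m ≤ b → b ≤ 2 * infoStar c ω μ * (m + 1) →
      infoStar c ω μ * ∫ x, (windowTime c ω b m x : ℝ) ∂lawChange μ 1
        ≤ b + (p * c ^ 2 / 2 + η) * Real.log m + C := by
  obtain ⟨C, hC⟩ := exists_integral_logLR_windowTime_le μ hI hη
  obtain ⟨C', hC'⟩ := exists_neg_integral_sum_remainder_le μ hI
  refine ⟨C + C' + infoStar c ω μ, fun m hm b hb hb' => ?_⟩
  have hinnov := isInnovation_dotProduct_noise μ (muStar c ω μ)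
  have hWm : HasMoments (fun x => ∑ i ∈ Finset.range (windowTime c ω b m x),
      muStar c ω μ ⬝ᵥ noise μ i x) (lawChange μ 1) :=
    hasMoments_sum_range_windowTime μ fun j => by fun_prop
  have hremm := hasMoments_sum_range_windowTime (c := c) (ω := ω) (b := b) (m := m) μ
    (hasMoments_remainder c ω μ)
  have hmean : ∫ x, logLR c ω (windowTime c ω b m x) x ∂lawChange μ 1
      = (∫ x, (windowTime c ω b m x : ℝ) ∂lawChange μ 1) * infoStar c ω μ
        + ∫ x, ∑ i ∈ Finset.range (windowTime c ω b m x), remainder c ω μ i x ∂lawChange μ 1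
        - infoStar c ω μ := by
    simp only [logLR_windowTime_eq μ hm]
    rw [integral_sub, integral_add, integral_add, integral_mul_const, integral_add,
      hinnov.integral_sum_range_eq_zero (measurableSet_lt_windowTime c ω b m)
        (windowTime_le c ω b m), hinnov.integral_eq_zero]
    · simp
    all_goals exact HasMoments.integrable (by fun_prop)
  linarith [hC m hm b hb, hC' m hm b hb hb']

theorem logLR_lt_of_lt_passageTime {b : ℝ} {n : ℕ} {x : Obs p} (hn : 1 ≤ n)
    (h : (n : ℕ∞) < passageTime c ω (Real.exp b) x) : logLR c ω n x < b := by
  have hmem : plugInLR c ω n 1 x ∉ Set.Ici (Real.exp b) :=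
    notMem_of_lt_hittingAfter (u := fun n x => plugInLR c ω n 1 x) h hn
  exact (Real.log_lt_iff_lt_exp (plugInLR_pos c ω n 1 x)).2 (not_le.1 hmem)

theorem lintegral_passageTime_le {m : ℕ} (hm : 1 ≤ m) (b : ℝ) :
    ∫⁻ x, (passageTime c ω (Real.exp b) x : ℝ≥0∞) ∂lawChange μ 1
      ≤ ENNReal.ofReal (∫ x, (windowTime c ω b m x : ℝ) ∂lawChange μ 1)
        + ∑' n, lawChange μ 1 {x | 8 * m ≤ n ∧ logLR c ω n x < b} := by
  have hwindow : ∫⁻ x, ((windowTime c ω b m x : ℕ∞) : ℝ≥0∞) ∂lawChange μ 1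
      = ENNReal.ofReal (∫ x, (windowTime c ω b m x : ℝ) ∂lawChange μ 1) := by
    rw [ofReal_integral_eq_lintegral_ofReal (hasMoments_windowTime μ).integrable
      (Filter.Eventually.of_forall fun x => Nat.cast_nonneg _)]
    simp
  rw [← hwindow, lintegral_toENNReal _ fun n =>
    (info p).le n _ (measurableSet_lt_passageTime c ω _ n), lintegral_toENNReal _ fun n => by
      simpa using (info p).le n _ (measurableSet_lt_windowTime c ω b m n), ← ENNReal.tsum_add]
  refine ENNReal.tsum_le_tsum fun n => (measure_mono ?_).trans (measure_union_le _ _)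
  intro x (hx : (n : ℕ∞) < passageTime c ω (Real.exp b) x)
  by_contra! hcon
  simp only [Set.mem_union, Set.mem_ofPred_eq, Nat.cast_lt, not_or, not_lt, not_and] at hcon
  have hmτ := le_windowTime c ω b m x
  have hτn : windowTime c ω b m x < 8 * m := by
    by_contra! hτ
    exact absurd (logLR_lt_of_lt_passageTime (by omega) hx) (hcon.2 (by omega)).not_gt
  exact absurd (le_logLR_windowTime hτn) (logLR_lt_of_lt_passageTime (by omega)
    ((Nat.cast_le.2 hcon.1).trans_lt hx)).not_ge

theorem measure_logLR_lt_le {C b : ℝ} {n : ℕ} (hI : 0 < infoStar c ω μ) (hn : 1 ≤ n)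
    (hb : b ≤ n * infoStar c ω μ / 2)
    (hC : ∫ x, (logLR c ω n x - n * infoStar c ω μ) ^ 4 ∂lawChange μ 1 ≤ C * n ^ 2) :
    (lawChange μ 1) {x | logLR c ω n x < b}
      ≤ ENNReal.ofReal (16 * C / infoStar c ω μ ^ 4 * (1 / n ^ 2)) := by
  have : (0 : ℝ) < n := by exact_mod_cast hn
  have hsub : {x | logLR c ω n x < b} ⊆
      {x | (n * infoStar c ω μ / 2) ^ 4 ≤ (logLR c ω n x - n * infoStar c ω μ) ^ 4} :=
    fun x hx => by
      have hx' : n * infoStar c ω μ / 2 ≤ n * infoStar c ω μ - logLR c ω n x := by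
        linarith [show logLR c ω n x < b from hx]
      rw [Set.mem_ofPred_eq, ← Even.neg_pow (by decide : Even 4) (logLR c ω n x - _), neg_sub]
      exact pow_le_pow_left₀ (by positivity) hx' 4
  have hmarkov := (mul_meas_ge_le_integral_of_nonneg
    (Filter.Eventually.of_forall fun x => by positivity)
    (HasMoments.integrable (by fun_prop)) ((n * infoStar c ω μ / 2) ^ 4)).trans hC
  refine (measure_mono hsub).trans ?_
  rw [← ofReal_measureReal]
  refine ENNReal.ofReal_le_ofReal ?_
  rw [← le_div_iff₀' (by positivity)] at hmarkov
  refine hmarkov.trans_eq ?_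
  field_simp
  norm_num

theorem exists_tsum_measure_logLR_lt_le (hI : 0 < infoStar c ω μ) :
    ∃ C, ∀ m : ℕ, 1 ≤ m → ∀ b, b ≤ 2 * infoStar c ω μ * (m + 1) →
      ∑' n, lawChange μ 1 {x | 8 * m ≤ n ∧ logLR c ω n x < b} ≤ ENNReal.ofReal C := by
  obtain ⟨C, hC⟩ := exists_integral_logLR_sub_pow_le c ω μ
  have hC0 : 0 ≤ C := by
    simpa using (integral_nonneg fun x => by positivity).trans (hC 1 le_rfl)
  have hsum : Summable fun n : ℕ => 16 * C / infoStar c ω μ ^ 4 * (1 / (n : ℝ) ^ 2) :=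
    (Real.summable_one_div_nat_pow.2 one_lt_two).mul_left _
  refine ⟨∑' n : ℕ, 16 * C / infoStar c ω μ ^ 4 * (1 / (n : ℝ) ^ 2), fun m hm b hb => ?_⟩
  rw [ENNReal.ofReal_tsum_of_nonneg (fun n => by positivity) hsum]
  refine ENNReal.tsum_le_tsum fun n => ?_
  by_cases hn : 8 * m ≤ n
  · have hmR : (1 : ℝ) ≤ m := by exact_mod_cast hm
    have hnR : (8 : ℝ) * m ≤ n := by exact_mod_cast hn
    have hbn : b ≤ n * infoStar c ω μ / 2 := by nlinarith
    simpa only [hn, true_and] using measure_logLR_lt_le μ hI (by omega) hbn (hC n (by omega))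
  · simp [hn]

theorem exists_lintegral_passageTime_le (hI : 0 < infoStar c ω μ) {η : ℝ} (hη : 0 < η) :
    ∃ C, ∀ m : ℕ, 1 ≤ m → ∀ b, 2 * infoStar c ω μ * m ≤ b → b ≤ 2 * infoStar c ω μ * (m + 1) →
      ∫⁻ x, (passageTime c ω (Real.exp b) x : ℝ≥0∞) ∂lawChange μ 1 ≤ ENNReal.ofReal
        ((b + (p * c ^ 2 / 2 + η) * Real.log m + C) / infoStar c ω μ) := by
  obtain ⟨C, hC⟩ := exists_mul_integral_windowTime_le μ hI hη
  obtain ⟨C', hC'⟩ := exists_tsum_measure_logLR_lt_le μ hI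
  refine ⟨C + infoStar c ω μ * max C' 0, fun m hm b hb hb' => ?_⟩
  calc ∫⁻ x, (passageTime c ω (Real.exp b) x : ℝ≥0∞) ∂lawChange μ 1
    _ ≤ ENNReal.ofReal (∫ x, (windowTime c ω b m x : ℝ) ∂lawChange μ 1)
          + ENNReal.ofReal (max C' 0) :=
      (lintegral_passageTime_le μ hm b).trans
        (add_le_add_right ((hC' m hm b hb').trans (ENNReal.ofReal_le_ofReal (le_max_left _ _))) _)
    _ = ENNReal.ofReal (∫ x, (windowTime c ω b m x : ℝ) ∂lawChange μ 1 + max C' 0) :=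
      (ENNReal.ofReal_add (integral_nonneg fun x => Nat.cast_nonneg _) (le_max_right _ _)).symm
    _ ≤ _ := by
      refine ENNReal.ofReal_le_ofReal ?_
      rw [le_div_iff₀' hI]
      linarith [hC m hm b hb hb']

theorem eventually_detectionDelay_alarmTime_le (hI : 0 < infoStar c ω μ) {η : ℝ} (hη : 0 < η) :
    ∀ᶠ B : ℝ in Filter.atTop, detectionDelay μ (alarmTime c ω B) ≤ ENNReal.ofReal
      ((Real.log B + (p * c ^ 2 / 2) * Real.log (Real.log B)
        - (p * c ^ 2 / 2) * Real.log (infoStar c ω μ)) / infoStar c ω μ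
        + η * Real.log (Real.log B)) := by
  obtain ⟨C, hC⟩ := exists_lintegral_passageTime_le μ hI (η := infoStar c ω μ * η / 2)
    (by positivity)
  set I := infoStar c ω μ
  have hb := Real.tendsto_log_atTop
  filter_upwards [hb.eventually_ge_atTop (2 * I), Filter.eventually_gt_atTop 0,
    (hb.comp hb).eventually_ge_atTop ((C - I * η / 2 * Real.log I) / (I * η / 2))]
    with B hbI hB hlarge
  refine (detectionDelay_alarmTime_le c ω μ B).trans ?_
  rw [← Real.exp_log hB, Real.log_exp]
  rw [Function.comp_apply, div_le_iff₀ (by positivity)] at hlarge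
  generalize Real.log B = b at hbI hlarge
  have hb0 : 0 < b := by linarith
  set m := ⌊b / (2 * I)⌋₊
  have hfloor : (m : ℝ) ≤ b / (2 * I) := Nat.floor_le (by positivity)
  have hm : 1 ≤ m := Nat.le_floor (by rwa [Nat.cast_one, le_div_iff₀ (by positivity), one_mul])
  have hlog : Real.log m ≤ Real.log b - Real.log I := by
    rw [← Real.log_div hb0.ne' hI.ne']
    refine Real.log_le_log (by exact_mod_cast hm) (hfloor.trans ?_)
    gcongr
    linarith
  have hslope : (p * c ^ 2 / 2 + I * η / 2) * Real.log m
      ≤ (p * c ^ 2 / 2 + I * η / 2) * (Real.log b - Real.log I) := by gcongr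
  refine (hC m hm b ?_ ?_).trans (ENNReal.ofReal_le_ofReal ?_)
  · rwa [le_div_iff₀' (by positivity)] at hfloor
  · exact ((div_lt_iff₀' (by positivity)).1 (Nat.lt_floor_add_one _)).le
  · rw [div_add' _ _ _ hI.ne']
    refine div_le_div_of_nonneg_right ?_ hI.le
    linarith

end PassageTime

theorem exists_isLittleO_of_forall_eventually_le_ofReal {α : Type*} {l : Filter α}
    {D : α → ℝ≥0∞} {a g : α → ℝ} (ha : ∀ᶠ x in l, 0 ≤ a x) (hg : ∀ᶠ x in l, 0 ≤ g x)
    (h : ∀ η > 0, ∀ᶠ x in l, D x ≤ ENNReal.ofReal (a x + η * g x)) :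
    ∃ r : α → ℝ, r =o[l] g ∧ ∀ᶠ x in l, D x ≤ ENNReal.ofReal (a x + r x) := by
  refine ⟨fun x => max 0 ((D x).toReal - a x), Asymptotics.isLittleO_iff.2 fun η hη => ?_, ?_⟩
  · filter_upwards [h η hη, ha, hg] with x hD ha hg
    have hηg : 0 ≤ η * g x := by positivity
    have hDa := ENNReal.toReal_le_of_le_ofReal (by positivity) hD
    rw [Real.norm_of_nonneg (le_max_left _ _), Real.norm_of_nonneg hg]
    exact max_le hηg (by linarith)
  · filter_upwards [h 1 one_pos] with x hD
    calc D x = ENNReal.ofReal (D x).toReal :=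
        (ENNReal.ofReal_toReal (hD.trans_lt ENNReal.ofReal_lt_top).ne).symm
      _ ≤ _ := ENNReal.ofReal_le_ofReal (by linarith [le_max_right 0 ((D x).toReal - a x)])

theorem pos_of_infoStar_pos {p : ℕ} {c : ℝ} {ω μ : Fin p → ℝ} (hI : 0 < infoStar c ω μ) :
    0 < p := by
  refine Nat.pos_of_ne_zero ?_
  rintro rfl
  simp [infoNumber_zero_right] at hI

end SRRS

theorem theorem3_general {p : ℕ} (c : ℝ) (ω : Fin p → ℝ) :
    (∀ B : ℝ, ENNReal.ofReal B ≤ SRRS.avgRunLength (SRRS.alarmTime c ω B)) ∧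
    (∀ (μ : Fin p → ℝ) (I : ℝ), I = SRRS.infoNumber (SRRS.muStar c ω μ) 0 μ → 0 < I →
      ∃ r : ℝ → ℝ,
        r =o[Filter.atTop] (fun B : ℝ => (p : ℝ) * Real.log (Real.log B)) ∧
        ∀ᶠ B : ℝ in Filter.atTop,
          SRRS.detectionDelay μ (SRRS.alarmTime c ω B) ≤
            ENNReal.ofReal
              ((Real.log B + ((p : ℝ) * c ^ 2 / 2) * Real.log (Real.log B)
                  - ((p : ℝ) * c ^ 2 / 2) * Real.log I) / I
                + r B)) := by
  refine ⟨SRRS.ofReal_le_avgRunLength_alarmTime c ω, ?_⟩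
  rintro μ I rfl hI
  have hp : (0 : ℝ) < p := by exact_mod_cast SRRS.pos_of_infoStar_pos hI
  have hlog := Real.tendsto_log_atTop
  refine SRRS.exists_isLittleO_of_forall_eventually_le_ofReal ?_ ?_ fun η hη => ?_
  · filter_upwards [hlog.eventually_ge_atTop 0, (hlog.comp hlog).eventually_ge_atTop
      (Real.log (SRRS.infoStar c ω μ))] with B hB hloglog
    rw [add_sub_assoc, ← mul_sub]
    exact div_nonneg (add_nonneg hB (mul_nonneg (by positivity) (sub_nonneg.2 hloglog))) hI.le
  · filter_upwards [(hlog.comp hlog).eventually_ge_atTop 0] with B hB using mul_nonneg hp.le hB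
  · simpa only [mul_assoc] using
      SRRS.eventually_detectionDelay_alarmTime_le μ hI (mul_pos hη hp)

theorem theorem3 {p : ℕ} (c : ℝ) (hc0 : 0 ≤ c) (hc1 : c ≤ 1) (ω : Fin p → ℝ) :
    (∀ B : ℝ, 0 < B → ENNReal.ofReal B ≤ SRRS.avgRunLength (SRRS.alarmTime c ω B)) ∧
    (∀ (μ : Fin p → ℝ) (I : ℝ), I = SRRS.infoNumber (SRRS.muStar c ω μ) 0 μ → 0 < I →
      ∃ r : ℝ → ℝ,
        r =o[Filter.atTop] (fun B : ℝ => (p : ℝ) * Real.log (Real.log B)) ∧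
        ∀ᶠ B : ℝ in Filter.atTop,
          SRRS.detectionDelay μ (SRRS.alarmTime c ω B) ≤
            ENNReal.ofReal
              ((Real.log B + ((p : ℝ) * c ^ 2 / 2) * Real.log (Real.log B)
                  - ((p : ℝ) * c ^ 2 / 2) * Real.log I) / I
                + r B)) :=
  ⟨fun B _ => (theorem3_general c ω).1 B, (theorem3_general c ω).2⟩
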